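/- **Theorem (Fractional Solution).** Let $\mathcal N$ be a finite ground set with $|\mathcal N| = n$, and let $\mathcal M=(\mathcal N,\mathcal I)$ be a matroid of rank $r$. A function $f\colon 2^{\mathcal N}\to\mathbb R_{\ge 0}$ is submodular if $f(S)+f(T)\ge f(S\cap T)+f(S\cup T)$ for all $S,T\subseteq\mathcal N$; $OPT$ denotes a set in $\mathcal I$ maximizing $f$ over $\mathcal I$; $P(\mathcal M)$ is the convex hull of the characteristic vectors $\mathbf 1_S\in\{0,1\}^{\mathcal N}$ of the sets $S\in\mathcal I$. For $x\in[0,1]^{\mathcal N}$ and $y\in[0,1]^{2^{\mathcal N}}$ let $$\bar F(x)=\sum_{S\subseteq\mathcal N} f(S)\prod_{u\in S}x_u\prod_{u\notin S}(1-x_u),\qquad F(y)=\sum_{J\subseteq 2^{\mathcal N}} f\Big(\bigcup_{S\in J}S\Big)\prod_{S\in J}y_S\prod_{S\in 2^{\mathcal N}\setminus J}(1-y_S),$$ let $\operatorname{marg}(y)\in[0,1]^{\mathcal N}$ be given by $\operatorname{marg}_u(y)=1-\prod_{S\ni u}(1-y_S)$, and let $\operatorname{supp}(y)$ be the number of non-zero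 coordinates of $y$. There is a deterministic algorithm that is given the finite ground set $\mathcal N$ and a parameter $\varepsilon\in(0,1)$, and accesses a matroid $\mathcal M=(\mathcal N,\mathcal I)$ and a non-negative submodular function $f\colon 2^{\mathcal N}\to\mathbb R_{\ge0}$ only through an independence oracle (is $S\in\mathcal I$?) and a value oracle (what is $f(S)$?), its cost being the number of queries (it is an adaptive query strategy; computation between queries is not counted). It produces a vector $y\in[0,1]^{2^{\mathcal N}}$ such that * $\operatorname{marg}(y)\in P(\mathcal M)$; * $\operatorname{supp}(y)\le C/\varepsilon^{4}$ for a universal constant $C$; * $F(y)\ge(1/e-\varepsilon)\,f(OPT)$ and, if $f$ is monotone, $F(y)\ge(1-1/e-\varepsilon)\,f(OPT)$. It uses at most $K(\varepsilon)\cdot n\log\max\{r,2\}$ value queries and at most $K(\varepsilon)\cdot n\log\max\{r,2\}$ independence queries, where $K(\varepsilon)$ depends only on $\varepsilon$; that is, $O_\varepsilon(n\log r)$ queries for $r\ge2$, and $O_\varepsilon(n)$ for $r\le 1$. Additionally, without making any further queries, the algorithm can also produce random sets $S_1,\dots,S_m$, where $m=\lceil 1/\varepsilon\rceil^{3}$ (so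 that $m=1/\varepsilon^3$ when $1/\varepsilon$ is an integer), which are always independent in $\mathcal M$, such that the convex combination $x=\frac1m\sum_{i=1}^{m}\mathbf 1_{S_i}$ satisfies $\mathbb E[\bar F(x)]\ge F(y)$. -/

import Mathlib

universe u v

/-- A deterministic adaptive algorithm (decision tree) over the ground set `α` with access to a
value oracle and an independence oracle: it either stops with an output, or asks for the value of
the objective on a set `S`, or asks whether `S` is independent, and continues depending on the
answer. Computation between queries is free. -/
inductive OracleAlg (α : Type u) (β : Type v) : Type (max u v) where
  | ret (b : β) : OracleAlg α β
  | value (S : Finset α) (next : ℝ → OracleAlg α β) : OracleAlg α β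
  | indep (S : Finset α) (next : Bool → OracleAlg α β) : OracleAlg α β

namespace OracleAlg

variable {α : Type u} {β : Type v}

open Classical in
/-- The output of the algorithm when the oracles answer according to `M` and `f`. -/
noncomputable def run (M : Matroid α) (f : Finset α → ℝ) : OracleAlg α β → β
  | ret b => b
  | value S next => (next (f S)).run M f
  | indep S next => (next (decide (M.Indep (S : Set α)))).run M f

open Classical in
/-- The number of value queries made when the oracles answer according to `M` and `f`. -/
noncomputable def valueQueries (M : Matroid α) (f : Finset α → ℝ) : OracleAlg α β → ℕ
  | ret _ => 0
  | value S next => (next (f S)).valueQueries M f + 1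
  | indep S next => (next (decide (M.Indep (S : Set α)))).valueQueries M f

open Classical in
/-- The number of independence queries made when the oracles answer according to `M` and `f`. -/
noncomputable def indepQueries (M : Matroid α) (f : Finset α → ℝ) : OracleAlg α β → ℕ
  | ret _ => 0
  | value S next => (next (f S)).indepQueries M f
  | indep S next => (next (decide (M.Indep (S : Set α)))).indepQueries M f + 1

end OracleAlg

/-- What the algorithm outputs: a vector `y` indexed by the subsets of the ground set, and (the
law of) a random tuple of `m` sets. Since both sit in the leaf that the algorithm reaches,
sampling the tuple takes no query beyond those made to compute `y`. -/
structure FractionalOutput (α : Type u) (m : ℕ) where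
  /-- the fractional solution -/
  y : Finset α → ℝ
  /-- the law of the random sets `S₁, …, S_m` -/
  law : PMF (Fin m → Finset α)

section

variable {α : Type u} [DecidableEq α]

/-- Submodularity of a set function. -/
def IsSubmodular (f : Finset α → ℝ) : Prop :=
  ∀ S T : Finset α, f (S ∩ T) + f (S ∪ T) ≤ f S + f T

/-- `O` is an independent set of maximum value. -/
def IsOptimal (M : Matroid α) (f : Finset α → ℝ) (O : Finset α) : Prop :=
  M.Indep (O : Set α) ∧ ∀ S : Finset α, M.Indep (S : Set α) → f S ≤ f O

/-- The characteristic vector of a set. -/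
def charVec (S : Finset α) : α → ℝ := fun u => if u ∈ S then 1 else 0

/-- The matroid polytope: the convex hull of the characteristic vectors of independent sets. -/
def matroidPolytope (M : Matroid α) : Set (α → ℝ) :=
  convexHull ℝ {x | ∃ S : Finset α, M.Indep (S : Set α) ∧ x = charVec S}

/-- The average `(1/m) ∑ᵢ 1_{Sᵢ}` of the characteristic vectors of `m` sets. -/
noncomputable def avgVec {m : ℕ} (S : Fin m → Finset α) : α → ℝ :=
  fun u => (1 / (m : ℝ)) * ∑ i, charVec (S i) u

variable [Fintype α]

/-- The (standard) multilinear extension of a set function. -/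
def multilinearExt (f : Finset α → ℝ) (x : α → ℝ) : ℝ :=
  ∑ S : Finset α, f S * (∏ u ∈ S, x u) * ∏ u ∈ Sᶜ, (1 - x u)

/-- The extended multilinear extension of a set function; `J.sup id` is the union of the members
of the collection `J`. -/
def extMultilinearExt (f : Finset α → ℝ) (y : Finset α → ℝ) : ℝ :=
  ∑ J : Finset (Finset α), f (J.sup id) * (∏ S ∈ J, y S) * ∏ S ∈ Jᶜ, (1 - y S)

/-- The marginal vector of `y`. -/
def marg (y : Finset α → ℝ) : α → ℝ :=
  fun u => 1 - ∏ S : Finset α with u ∈ S, (1 - y S)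

/-- The number of non-zero coordinates of `y`. -/
noncomputable def suppSize (y : Finset α → ℝ) : ℕ := Set.ncard {S : Finset α | y S ≠ 0}

/-- The expected value of the multilinear extension at the average of the random sets. -/
noncomputable def expectedMultilinearExt (f : Finset α → ℝ) {m : ℕ}
    (law : PMF (Fin m → Finset α)) : ℝ :=
  ∑ S : Fin m → Finset α, (law S).toReal * multilinearExt f (avgVec S)

end

/-! Put `N = ⌈1/ε⌉`, `m = N ^ 3`, `δ = 1 / m`. The algorithm builds `m` splits, each made of `N`
disjoint pieces whose union is independent. Let `R` be the union of a random selection of the pieces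
found so far, each kept independently with probability `δ`. The next split is chosen greedily for `g
S = E[f (R ∪ S)]`, which is again non-negative and submodular. The vector `y` gives each piece
probability `δ` (repetitions combined), so `F(y)` is the final `E[f R]`
(`extMultilinearExt_occurProb`).

Gain of one split: decreasing thresholds ensure that, for the optimum `O` and every piece `T j`, `g
(O ∪ T j) - g (T j)` is at most `G / q` plus a small error, where `G` is the total gain of the
pieces and `q` the threshold ratio (`ExcessBounded.pass`, `ExcessBounded.union_sub_le`). Average
over `j`: the mean of `g (T j)` is `g ∅ + G / N`, and disjointness keeps the mean of `g (O ∪ T j)`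
above `(1 - 1/N) * g O` even without monotonicity (`le_avgUnion`). Hence `G` is at least about `g O
- g ∅`, and independent inclusion realizes `δ * G` up to second-order terms
(`IsSplit.le_randUnion`). With `a i` the value after `i` splits, `a (i + 1)` is at least about `(1 -
δ) * a i + δ * g O`. For monotone `f`, `g O ≥ f O` yields `1 - 1/e`; in general `g O ≥ (1 - δ) ^ i *
f O` (`SplitSetting.pow_mul_le_splitValue`) yields `1/e`.

Rounding: an element lying in `c` of the split unions has marginal `1 - (1 - δ) ^ c ≤ c / m`, so
`marg y` is dominated by the average of `m` independent sets. Deleting elements at random,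
simultaneously from all these sets, makes the average equal `marg y` in expectation, and by
multilinearity the expected extension is exactly its value at `marg y`. That value is at least
`F(y)`, since by submodularity breaking pieces into independent singletons does not hurt
(`IsSubmodular.randUnion_le_singletons`).

Queries: there are at most `N ^ 4` pieces, so `g` is evaluated exactly with a number of queries
bounded in terms of `ε` alone; only the number of thresholds grows with the rank, logarithmically.
-/

namespace OracleAlg

/-! ### Composing oracle algorithms and counting their queries. -/

section Monad

variable {α : Type u} {β γ σ ι : Type*}

/-- Sequential composition of oracle algorithms. -/
def bind : OracleAlg α β → (β → OracleAlg α γ) → OracleAlg α γ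
  | ret b, k => k b
  | value S next, k => value S fun x => (next x).bind k
  | indep S next, k => indep S fun x => (next x).bind k

theorem run_bind (M : Matroid α) (f : Finset α → ℝ) (A : OracleAlg α β)
    (k : β → OracleAlg α γ) : (A.bind k).run M f = (k (A.run M f)).run M f := by
  induction A with
  | ret b => rfl
  | value S next ih => simp only [bind, run, ih]
  | indep S next ih => simp only [bind, run, ih]

theorem valueQueries_bind (M : Matroid α) (f : Finset α → ℝ) (A : OracleAlg α β)
    (k : β → OracleAlg α γ) :
    (A.bind k).valueQueries M f = A.valueQueries M f + (k (A.run M f)).valueQueries M f := by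
  induction A with
  | ret b => simp [bind, run, valueQueries]
  | value S next ih => simp only [bind, run, valueQueries, ih]; omega
  | indep S next ih => simp only [bind, run, valueQueries, ih]

theorem indepQueries_bind (M : Matroid α) (f : Finset α → ℝ) (A : OracleAlg α β)
    (k : β → OracleAlg α γ) :
    (A.bind k).indepQueries M f = A.indepQueries M f + (k (A.run M f)).indepQueries M f := by
  induction A with
  | ret b => simp [bind, run, indepQueries]
  | value S next ih => simp only [bind, run, indepQueries, ih]
  | indep S next ih => simp only [bind, run, indepQueries, ih]; omega

/-- Run a step for each entry of a list, threading a state. -/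
def fold (step : ι → σ → OracleAlg α σ) : List ι → σ → OracleAlg α σ
  | [], s => ret s
  | i :: l, s => (step i s).bind (fold step l)

theorem run_fold (M : Matroid α) (f : Finset α → ℝ) (step : ι → σ → OracleAlg α σ)
    (l : List ι) (s : σ) :
    (fold step l s).run M f = l.foldl (fun s i => (step i s).run M f) s := by
  induction l generalizing s with
  | nil => rfl
  | cons i l ih => simp only [fold, run_bind, ih, List.foldl_cons]

theorem valueQueries_fold_le (M : Matroid α) (f : Finset α → ℝ) (step : ι → σ → OracleAlg α σ)
    (c : ℕ) (h : ∀ i s, (step i s).valueQueries M f ≤ c) (l : List ι) (s : σ) :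
    (fold step l s).valueQueries M f ≤ l.length * c := by
  induction l generalizing s with
  | nil => simp [fold, valueQueries]
  | cons i l ih =>
    simp only [fold, valueQueries_bind, List.length_cons]
    have := h i s
    have := ih ((step i s).run M f)
    linarith

theorem indepQueries_fold_le (M : Matroid α) (f : Finset α → ℝ) (step : ι → σ → OracleAlg α σ)
    (c : ℕ) (h : ∀ i s, (step i s).indepQueries M f ≤ c) (l : List ι) (s : σ) :
    (fold step l s).indepQueries M f ≤ l.length * c := by
  induction l generalizing s with
  | nil => simp [fold, indepQueries]
  | cons i l ih =>
    simp only [fold, indepQueries_bind, List.length_cons]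
    have := h i s
    have := ih ((step i s).run M f)
    linarith

end Monad

end OracleAlg

/-! ### Random unions of sets and submodular inequalities for them. -/

section Extension

variable {α : Type u} [DecidableEq α]

/-- The expectation of `f (R ∪ S)`, where `R` is the union of the random sublist of `L` that keeps
each entry independently with probability `δ`. -/
def randUnion (δ : ℝ) (f : Finset α → ℝ) : List (Finset α) → Finset α → ℝ
  | [], S => f S
  | T :: L, S => (1 - δ) * randUnion δ f L S + δ * randUnion δ f L (T ∪ S)

/-- The expectation is taken in two stages. This lets a new split be analysed as a first step for
the objective averaged over the older pieces. -/
theorem randUnion_append (δ : ℝ) (f : Finset α → ℝ) (L L' : List (Finset α)) (S : Finset α) :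
    randUnion δ f (L ++ L') S = randUnion δ (randUnion δ f L') L S := by
  induction L generalizing S with
  | nil => rfl
  | cons T L ih => simp only [List.cons_append, randUnion, ih]

variable {δ : ℝ} {f g : Finset α → ℝ}

theorem randUnion_nonneg (h0 : 0 ≤ δ) (h1 : δ ≤ 1) (hf : ∀ S, 0 ≤ f S) (L : List (Finset α))
    (S : Finset α) : 0 ≤ randUnion δ f L S := by
  induction L generalizing S with
  | nil => exact hf S
  | cons T L ih =>
    have := mul_nonneg (sub_nonneg.2 h1) (ih S)
    have := mul_nonneg h0 (ih (T ∪ S))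
    simp only [randUnion]; linarith

theorem randUnion_monotone (h0 : 0 ≤ δ) (h1 : δ ≤ 1) (hf : Monotone f) (L : List (Finset α)) :
    Monotone (randUnion δ f L) := by
  induction L with
  | nil => exact hf
  | cons T L ih =>
    intro S S' h
    have := mul_le_mul_of_nonneg_left (ih h) (sub_nonneg.2 h1)
    have := mul_le_mul_of_nonneg_left (ih (Finset.union_subset_union_right (s := T) h)) h0
    simp only [randUnion]; linarith

theorem randUnion_isSubmodular (h0 : 0 ≤ δ) (h1 : δ ≤ 1) (hf : IsSubmodular f)
    (L : List (Finset α)) : IsSubmodular (randUnion δ f L) := by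
  induction L with
  | nil => exact hf
  | cons T L ih =>
    intro S S'
    have a := mul_le_mul_of_nonneg_left (ih S S') (sub_nonneg.2 h1)
    have b := mul_le_mul_of_nonneg_left (ih (T ∪ S) (T ∪ S')) h0
    rw [← Finset.union_inter_distrib_left, ← Finset.union_union_distrib_left] at b
    simp only [randUnion]; linarith

theorem le_randUnion (h0 : 0 ≤ δ) (h1 : δ ≤ 1) (hf : Monotone f) (L : List (Finset α))
    (S : Finset α) : f S ≤ randUnion δ f L S := by
  induction L generalizing S with
  | nil => exact le_rfl
  | cons T L ih =>
    have a := mul_le_mul_of_nonneg_left (ih S) (sub_nonneg.2 h1)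
    have b := mul_le_mul_of_nonneg_left
      ((hf (Finset.subset_union_right (s₁ := T) (s₂ := S))).trans (ih (T ∪ S))) h0
    simp only [randUnion]; linarith

/-- By distributivity, `T ∪ S` and `U ∪ S` meet in exactly `S`. -/
theorem IsSubmodular.union_add_le (hf : IsSubmodular f) {T U : Finset α} (h : Disjoint T U)
    (S : Finset α) : f S + f (T ∪ (U ∪ S)) ≤ f (T ∪ S) + f (U ∪ S) := by
  have := hf (T ∪ S) (U ∪ S)
  rwa [← Finset.inter_union_distrib_right, Finset.disjoint_iff_inter_eq_empty.1 h,
    Finset.empty_union, ← Finset.union_union_distrib_right, Finset.union_assoc] at this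

/-- The condition `hu` excludes the one bad case `u ∈ T \ S`, where the left side is zero while the
right side may be negative. -/
theorem IsSubmodular.insert_sub_le (hf : IsSubmodular f) {S T : Finset α} (h : S ⊆ T) (u : α)
    (hu : u ∈ T → u ∈ S) : f (insert u T) - f T ≤ f (insert u S) - f S := by
  have := hf (insert u S) T
  have e : insert u S ∩ T = S := by
    ext x; simp only [Finset.mem_inter, Finset.mem_insert]
    constructor
    · rintro ⟨rfl | h1, h2⟩
      · exact hu h2
      · exact h1
    · exact fun hx => ⟨Or.inr hx, h hx⟩
  have e' : insert u S ∪ T = insert u T := by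
    rw [Finset.insert_union, Finset.union_eq_right.2 h]
  rw [e, e'] at this
  linarith

theorem IsSubmodular.union_sub_le_sum (hf : IsSubmodular f) (O T : Finset α) :
    f (O ∪ T) - f T ≤ ∑ o ∈ O, (f (insert o T) - f T) := by
  induction O using Finset.induction_on with
  | empty => simp
  | insert o O ho ih =>
    rw [Finset.sum_insert ho, Finset.insert_union]
    by_cases hT : o ∈ T
    · rw [Finset.insert_eq_of_mem (Finset.mem_union_right _ hT), Finset.insert_eq_of_mem hT]
      linarith
    · have := hf.insert_sub_le (Finset.subset_union_right (s₁ := O) (s₂ := T)) o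
        (by simp [ho])
      linarith

theorem disjoint_foldr_union {T : Finset α} {L : List (Finset α)} (h : ∀ U ∈ L, Disjoint T U) :
    Disjoint T (L.foldr (· ∪ ·) ∅) := by
  induction L with
  | nil => simp
  | cons U L ih =>
    simp only [List.mem_cons, forall_eq_or_imp] at h
    simpa [Finset.disjoint_union_right] using ⟨h.1, ih h.2⟩

/-- For pairwise disjoint sets, including the entries independently is at least as good as
including either all of them or none of them. -/
theorem IsSubmodular.le_randUnion_of_pairwise (h0 : 0 ≤ δ) (h1 : δ ≤ 1) (hf : IsSubmodular f)
    {L : List (Finset α)} (hL : L.Pairwise Disjoint) (S : Finset α) :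
    (1 - δ) * f S + δ * f (L.foldr (· ∪ ·) ∅ ∪ S) ≤ randUnion δ f L S := by
  induction L generalizing S with
  | nil => simp only [List.foldr_nil, Finset.empty_union, randUnion]; linarith
  | cons T L ih =>
    rw [List.pairwise_cons] at hL
    have a := mul_le_mul_of_nonneg_left (ih hL.2 S) (sub_nonneg.2 h1)
    have b := mul_le_mul_of_nonneg_left (ih hL.2 (T ∪ S)) h0
    have c := mul_le_mul_of_nonneg_left (hf.union_add_le (disjoint_foldr_union hL.1) S)
      (mul_nonneg h0 (sub_nonneg.2 h1))
    rw [Finset.union_left_comm] at b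
    simp only [randUnion, List.foldr_cons, Finset.union_assoc]
    linarith

theorem IsSubmodular.sub_mul_le_randUnion (h0 : 0 ≤ δ) (h1 : δ ≤ 1) (hf : IsSubmodular f)
    (hf0 : ∀ S, 0 ≤ f S) {L : List (Finset α)} (hL : L.Pairwise Disjoint) (S : Finset α) :
    (1 - δ) * f S ≤ randUnion δ f L S := by
  have := hf.le_randUnion_of_pairwise h0 h1 hL S
  have := mul_nonneg h0 (hf0 (L.foldr (· ∪ ·) ∅ ∪ S))
  linarith

theorem IsSubmodular.randUnion_le_of_pairwise (h0 : 0 ≤ δ) (h1 : δ ≤ 1) (hf : IsSubmodular f)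
    {L : List (Finset α)} (hL : L.Pairwise Disjoint) (S : Finset α) :
    randUnion δ f L S ≤ f S + δ * (L.map fun T => f (T ∪ S) - f S).sum := by
  induction L generalizing S with
  | nil => simp [randUnion]
  | cons T L ih =>
    rw [List.pairwise_cons] at hL
    have a := mul_le_mul_of_nonneg_left (ih hL.2 S) (sub_nonneg.2 h1)
    have b := mul_le_mul_of_nonneg_left (ih hL.2 (T ∪ S)) h0
    have c : (L.map fun U => f (U ∪ (T ∪ S)) - f (T ∪ S)).sum
        ≤ (L.map fun U => f (U ∪ S) - f S).sum := by
      refine List.sum_le_sum fun U hU => ?_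
      have := hf.union_add_le (hL.1 U hU).symm S
      linarith
    have c' := mul_le_mul_of_nonneg_left c (mul_nonneg h0 h0)
    simp only [randUnion, List.map_cons, List.sum_cons]
    linarith

/-- The first-order gain of including disjoint sets independently with probability `δ`. -/
theorem IsSubmodular.add_gain_le_randUnion (h0 : 0 ≤ δ) (h1 : δ ≤ 1) (hf : IsSubmodular f)
    (hf0 : ∀ S, 0 ≤ f S) {L : List (Finset α)} (hL : L.Pairwise Disjoint)
    (hg : ∀ T ∈ L, f ∅ ≤ f T) :
    f ∅ + δ * ((1 - L.length * δ) * (L.map fun T => f T - f ∅).sum - L.length * δ * f ∅)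
      ≤ randUnion δ f L ∅ := by
  induction L with
  | nil => simp [randUnion]
  | cons T L ih =>
    rw [List.pairwise_cons] at hL
    simp only [List.mem_cons, forall_eq_or_imp] at hg
    have a := ih hL.2 hg.2
    have b := mul_le_mul_of_nonneg_left (hf.sub_mul_le_randUnion h0 h1 hf0 hL.2 T) h0
    have c := mul_le_mul_of_nonneg_left (hf.randUnion_le_of_pairwise h0 h1 hL.2 ∅) h0
    -- The gain of `T` occurs with coefficient `δ * (1 - δ)`, but only `δ * (1 - (L.length + 1) *
    -- δ)` is needed; this is the surplus.
    have d : 0 ≤ (L.length : ℝ) * (δ * δ) * (f T - f ∅) :=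
      mul_nonneg (by positivity) (sub_nonneg.2 hg.1)
    simp only [Finset.union_empty] at c
    simp only [randUnion, List.map_cons, List.sum_cons, List.length_cons,
      Finset.union_empty, Nat.cast_succ]
    nlinarith

/-- Merging the sets one at a time costs one `f S` per merge. Once the value at the full union is
dropped as non-negative, disjoint additions retain `f S` on average up to a factor `1 - 1 /
L.length`: the substitute for monotonicity. -/
theorem IsSubmodular.sum_disjoint_ge (hf : IsSubmodular f) {L : List (Finset α)}
    (hL : L.Pairwise Disjoint) (S : Finset α) :
    (L.length - 1) * f S + f (L.foldr (· ∪ ·) ∅ ∪ S) ≤ (L.map fun T => f (T ∪ S)).sum := by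
  induction L with
  | nil => simp
  | cons T L ih =>
    rw [List.pairwise_cons] at hL
    have := hf.union_add_le (disjoint_foldr_union hL.1) S
    have := ih hL.2
    simp only [List.map_cons, List.sum_cons, List.length_cons, List.foldr_cons,
      Finset.union_assoc, Nat.cast_succ]
    linarith

theorem foldr_union_map_singleton (l : List α) :
    ((l.map fun u => ({u} : Finset α)).foldr (· ∪ ·) ∅) = l.toFinset := by
  induction l with
  | nil => rfl
  | cons a l ih => simp only [List.map_cons, List.foldr_cons, ih, List.toFinset_cons]; rfl

/-- Replacing sets by their elements, included independently, does not decrease the expectation. -/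
theorem IsSubmodular.randUnion_le_singletons (h0 : 0 ≤ δ) (h1 : δ ≤ 1) (hf : IsSubmodular f)
    (L : List (Finset α)) (S : Finset α) :
    randUnion δ f L S
      ≤ randUnion δ f ((L.flatMap Finset.toList).map fun u => {u}) S := by
  induction L generalizing S with
  | nil => exact le_rfl
  | cons T L ih =>
    have hd : ((T.toList).map fun u => ({u} : Finset α)).Pairwise Disjoint := by
      rw [List.pairwise_map]
      exact (Finset.nodup_toList T).imp fun h => by simpa using h
    -- Averaging over the singletons of the tail leaves a submodular function, so the disjoint case
    -- applies to the singletons of `T` with that function as objective.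
    have key := (randUnion_isSubmodular h0 h1 hf ((L.flatMap Finset.toList).map fun u => {u})
      ).le_randUnion_of_pairwise h0 h1 hd S
    rw [foldr_union_map_singleton, Finset.toList_toFinset] at key
    rw [List.flatMap_cons, List.map_append, randUnion_append]
    have a := mul_le_mul_of_nonneg_left (ih S) (sub_nonneg.2 h1)
    have b := mul_le_mul_of_nonneg_left (ih (T ∪ S)) h0
    simp only [randUnion]
    linarith

/-- Thanks to this bound, one initial threshold, the best singleton value of `f` itself, serves all
the averaged objectives. -/
theorem IsSubmodular.randUnion_insert_sub_le (h0 : 0 ≤ δ) (h1 : δ ≤ 1) (hf : IsSubmodular f)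
    (hf0 : ∀ S, 0 ≤ f S) (L : List (Finset α)) (u : α) (S : Finset α) :
    randUnion δ f L (insert u S) - randUnion δ f L S ≤ f {u} := by
  induction L generalizing S with
  | nil =>
    by_cases hu : u ∈ S
    · simpa [randUnion, Finset.insert_eq_of_mem hu] using hf0 {u}
    · have := hf.insert_sub_le (Finset.empty_subset S) u (fun h => absurd h hu)
      have := hf0 ∅
      simp only [randUnion]
      simp only [insert_empty_eq] at *
      linarith
  | cons T L ih =>
    have a := mul_le_mul_of_nonneg_left (ih S) (sub_nonneg.2 h1)
    have b := mul_le_mul_of_nonneg_left (ih (T ∪ S)) h0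
    simp only [randUnion, Finset.union_insert]
    linarith

namespace OracleAlg

/-- Evaluate `randUnion δ f L S` by `2 ^ L.length` value queries. -/
def evalUnion (δ : ℝ) : List (Finset α) → Finset α → OracleAlg α ℝ
  | [], S => value S ret
  | T :: L, S => (evalUnion δ L S).bind fun a => (evalUnion δ L (T ∪ S)).bind fun b =>
      ret ((1 - δ) * a + δ * b)

theorem run_evalUnion (M : Matroid α) (f : Finset α → ℝ) (δ : ℝ) (L : List (Finset α))
    (S : Finset α) : (evalUnion δ L S).run M f = randUnion δ f L S := by
  induction L generalizing S with
  | nil => rfl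
  | cons T L ih => simp only [evalUnion, run_bind, ih, run, randUnion]

theorem valueQueries_evalUnion (M : Matroid α) (f : Finset α → ℝ) (δ : ℝ) (L : List (Finset α))
    (S : Finset α) : (evalUnion δ L S).valueQueries M f = 2 ^ L.length := by
  induction L generalizing S with
  | nil => rfl
  | cons T L ih =>
    simp only [evalUnion, valueQueries_bind, ih, valueQueries, List.length_cons]; ring

theorem indepQueries_evalUnion (M : Matroid α) (f : Finset α → ℝ) (δ : ℝ) (L : List (Finset α))
    (S : Finset α) : (evalUnion δ L S).indepQueries M f = 0 := by
  induction L generalizing S with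
  | nil => rfl
  | cons T L ih => simp only [evalUnion, indepQueries_bind, ih, indepQueries]

end OracleAlg

end Extension

/-! ### Multilinear extensions as expectations over product distributions. -/

section Multilinear

variable {α : Type u} [DecidableEq α] [Fintype α]

theorem multilinearExt_eq_sum_prod_ite (g : Finset α → ℝ) (p : α → ℝ) :
    multilinearExt g p = ∑ J : Finset α, g J * ∏ u, if u ∈ J then p u else 1 - p u := by
  unfold multilinearExt
  refine Finset.sum_congr rfl fun J _ => ?_
  rw [mul_assoc, ← Finset.prod_mul_prod_compl J (fun u => if u ∈ J then p u else 1 - p u)]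
  congr 2
  · exact Finset.prod_congr rfl fun u hu => by simp [hu]
  · exact Finset.prod_congr rfl fun u hu => by simp [Finset.mem_compl.1 hu]

/-- Conditioning the random set on whether it contains `b`. -/
theorem multilinearExt_eq_sum_erase (g : Finset α → ℝ) (p : α → ℝ) (b : α) :
    multilinearExt g p = ∑ J ∈ (Finset.univ.erase b).powerset,
      ((1 - p b) * g J + p b * g (insert b J)) *
        ∏ u ∈ Finset.univ.erase b, if u ∈ J then p u else 1 - p u := by
  have hb : b ∉ (Finset.univ.erase b : Finset α) := Finset.notMem_erase b _
  rw [multilinearExt_eq_sum_prod_ite, ← Finset.powerset_univ,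
    ← Finset.insert_erase (Finset.mem_univ b), Finset.sum_powerset_insert hb,
    Finset.insert_erase (Finset.mem_univ b), ← Finset.sum_add_distrib]
  refine Finset.sum_congr rfl fun J hJ => ?_
  have hJb : b ∉ J := fun h => hb (Finset.mem_powerset.1 hJ h)
  rw [← Finset.mul_prod_erase _ _ (Finset.mem_univ b),
    ← Finset.mul_prod_erase _ _ (Finset.mem_univ b)]
  have e : ∏ u ∈ Finset.univ.erase b, (if u ∈ insert b J then p u else 1 - p u)
      = ∏ u ∈ Finset.univ.erase b, if u ∈ J then p u else 1 - p u :=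
    Finset.prod_congr rfl fun u hu => by simp [Finset.mem_insert, (Finset.mem_erase.1 hu).1]
  rw [e]
  simp only [hJb, if_false, Finset.mem_insert_self, if_true]
  ring

theorem multilinearExt_zero (g : Finset α → ℝ) : multilinearExt g 0 = g ∅ := by
  rw [multilinearExt_eq_sum_prod_ite, Finset.sum_eq_single ∅]
  · simp
  · intro J _ hJ
    obtain ⟨u, hu⟩ := Finset.nonempty_iff_ne_empty.2 hJ
    rw [Finset.prod_eq_zero (Finset.mem_univ u) (by simp [hu]), mul_zero]
  · simp

/-- The probability that an element occurs in the random sublist that keeps each entry of `l`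
independently with probability `δ`. -/
def occurProb (δ : ℝ) (l : List α) (u : α) : ℝ := 1 - (1 - δ) ^ l.count u

omit [Fintype α] in
theorem occurProb_mem_Icc {δ : ℝ} (h0 : 0 ≤ δ) (h1 : δ ≤ 1) (l : List α) (u : α) :
    occurProb δ l u ∈ Set.Icc (0 : ℝ) 1 := by
  have a : (1 - δ) ^ l.count u ≤ 1 := pow_le_one₀ (by linarith) (by linarith)
  have b : 0 ≤ (1 - δ) ^ l.count u := pow_nonneg (by linarith) _
  constructor <;> unfold occurProb <;> linarith

/-- A further entry `b` only changes coordinate `b`, from `p` to `1 - (1 - δ) * (1 - p)`: one more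
independent coin is tossed for `b`. -/
theorem multilinearExt_occurProb_cons (δ : ℝ) (g : Finset α → ℝ) (b : α) (l : List α) :
    multilinearExt g (occurProb δ (b :: l)) =
      (1 - δ) * multilinearExt g (occurProb δ l) +
        δ * multilinearExt (fun J => g (insert b J)) (occurProb δ l) := by
  rw [multilinearExt_eq_sum_erase g _ b, multilinearExt_eq_sum_erase g _ b,
    multilinearExt_eq_sum_erase _ _ b, Finset.mul_sum, Finset.mul_sum, ← Finset.sum_add_distrib]
  refine Finset.sum_congr rfl fun J _ => ?_
  have e : ∏ u ∈ Finset.univ.erase b,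
        (if u ∈ J then occurProb δ (b :: l) u else 1 - occurProb δ (b :: l) u)
      = ∏ u ∈ Finset.univ.erase b, if u ∈ J then occurProb δ l u else 1 - occurProb δ l u :=
    Finset.prod_congr rfl fun u hu => by
      rw [occurProb, List.count_cons_of_ne (Finset.ne_of_mem_erase hu).symm, occurProb]
  have e' : occurProb δ (b :: l) b = 1 - (1 - δ) * (1 - occurProb δ l b) := by
    simp only [occurProb, List.count_cons_self]; ring
  rw [e, e', Finset.insert_idem]
  ring

theorem multilinearExt_occurProb (δ : ℝ) (f : Finset α → ℝ) (l : List α) (S : Finset α) :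
    multilinearExt (fun J => f (J ∪ S)) (occurProb δ l) =
      randUnion δ f (l.map fun u => {u}) S := by
  induction l generalizing S with
  | nil =>
    have : occurProb δ ([] : List α) = 0 := by ext; simp [occurProb]
    rw [this, multilinearExt_zero]; simp [randUnion]
  | cons u l ih =>
    rw [multilinearExt_occurProb_cons, ih, List.map_cons, randUnion, ← ih ({u} ∪ S)]
    simp only [Finset.insert_union, Finset.singleton_union, Finset.union_insert]

/-- The extended extension is an ordinary one over the ground set `Finset α`, so `occurProb` can be
used at both levels. -/
theorem extMultilinearExt_eq (f : Finset α → ℝ) (y : Finset α → ℝ) :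
    extMultilinearExt f y = multilinearExt (fun J => f (J.sup id)) y := rfl

theorem multilinearExt_sup_occurProb (δ : ℝ) (f : Finset α → ℝ) (L : List (Finset α))
    (S : Finset α) :
    multilinearExt (fun J => f (J.sup id ∪ S)) (occurProb δ L) = randUnion δ f L S := by
  induction L generalizing S with
  | nil =>
    have : occurProb δ ([] : List (Finset α)) = 0 := by ext; simp [occurProb]
    rw [this, multilinearExt_zero]; simp [randUnion]
  | cons T L ih =>
    rw [multilinearExt_occurProb_cons, ih, randUnion, ← ih (T ∪ S)]
    simp only [Finset.sup_insert, id, Finset.sup_eq_union, Finset.union_left_comm,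
      Finset.union_assoc]

theorem extMultilinearExt_occurProb (δ : ℝ) (f : Finset α → ℝ) (L : List (Finset α)) :
    extMultilinearExt f (occurProb δ L) = randUnion δ f L ∅ := by
  rw [← multilinearExt_sup_occurProb]; simp [extMultilinearExt_eq]

/-- An element is missed exactly when every listed set containing it is dropped, so the exponents
add up. -/
theorem marg_occurProb (δ : ℝ) (L : List (Finset α)) :
    marg (occurProb δ L) = occurProb δ (L.flatMap Finset.toList) := by
  funext u
  have key : ∏ S : Finset α with u ∈ S, (1 - δ) ^ L.count S
      = (1 - δ) ^ (L.flatMap Finset.toList).count u := by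
    induction L with
    | nil => simp
    | cons T L ih =>
      rw [List.flatMap_cons, List.count_append, pow_add, ← ih]
      have h : ∀ S : Finset α, (1 - δ) ^ (T :: L).count S
          = (if T = S then (1 - δ) else 1) * (1 - δ) ^ L.count S := by
        intro S
        rw [List.count_cons]
        by_cases hS : T = S
        · simp [hS, pow_succ, mul_comm]
        · simp [hS]
      simp only [h, Finset.prod_mul_distrib]
      congr 1
      rw [Finset.prod_ite_eq]
      by_cases hu : u ∈ T
      · simp [hu, List.count_eq_one_of_mem (Finset.nodup_toList T) (Finset.mem_toList.2 hu)]
      · simp [hu, List.count_eq_zero_of_not_mem]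
  simp only [marg, occurProb, sub_sub_cancel, key]

omit [Fintype α] in
theorem suppSize_occurProb_le (δ : ℝ) (L : List (Finset α)) :
    suppSize (occurProb δ L) ≤ L.length := by
  have : {S : Finset α | occurProb δ L S ≠ 0} ⊆ (L.toFinset : Set (Finset α)) := by
    intro S hS
    by_contra h
    have h' : S ∉ L := by simpa using h
    exact hS (by simp [occurProb, List.count_eq_zero_of_not_mem h'])
  calc suppSize (occurProb δ L) ≤ (L.toFinset : Set (Finset α)).ncard :=
        Set.ncard_le_ncard this (Finset.finite_toSet _)
    _ ≤ L.length := by rw [Set.ncard_coe_finset]; exact L.toFinset_card_le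

/-- The probability that the random set with independent marginals `q` equals `Q`. -/
def productWeight (q : α → ℝ) (Q : Finset α) : ℝ := ∏ u, if u ∈ Q then q u else 1 - q u

theorem productWeight_nonneg {q : α → ℝ} (hq : ∀ u, q u ∈ Set.Icc (0 : ℝ) 1) (Q : Finset α) :
    0 ≤ productWeight q Q :=
  Finset.prod_nonneg fun u _ => by
    split_ifs
    · exact (hq u).1
    · exact sub_nonneg.2 (hq u).2

theorem sum_prod_ite (a b : α → ℝ) :
    ∑ Q : Finset α, ∏ u, (if u ∈ Q then a u else b u) = ∏ u, (a u + b u) := by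
  rw [Finset.prod_add, Finset.powerset_univ]
  refine Finset.sum_congr rfl fun Q _ => ?_
  rw [← Finset.prod_mul_prod_compl Q, Finset.compl_eq_univ_sdiff]
  congr 1
  · exact Finset.prod_congr rfl fun u hu => by simp [hu]
  · exact Finset.prod_congr rfl fun u hu => by simp [(Finset.mem_sdiff.1 hu).2]

theorem sum_productWeight (q : α → ℝ) : ∑ Q, productWeight q Q = 1 := by
  simp [productWeight, sum_prod_ite]

/-- The law of the random set that contains each `u` independently with probability `q u`. -/
noncomputable def productPMF (q : α → ℝ) (hq : ∀ u, q u ∈ Set.Icc (0 : ℝ) 1) : PMF (Finset α) :=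
  PMF.ofFintype (fun Q => ENNReal.ofReal (productWeight q Q)) (by
    rw [← ENNReal.ofReal_sum_of_nonneg fun Q _ => productWeight_nonneg hq Q,
      sum_productWeight, ENNReal.ofReal_one])

/-- Restricting a vector to a random set with independent marginals scales its multilinear
extension's argument. -/
theorem sum_productWeight_mul_multilinearExt (f : Finset α → ℝ) (q c : α → ℝ) :
    ∑ Q, productWeight q Q * multilinearExt f (fun u => if u ∈ Q then c u else 0) =
      multilinearExt f fun u => q u * c u := by
  simp only [multilinearExt_eq_sum_prod_ite, Finset.mul_sum]
  rw [Finset.sum_comm]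
  refine Finset.sum_congr rfl fun J _ => ?_
  have h : ∀ Q : Finset α, productWeight q Q * (f J * ∏ u, if u ∈ J then
      (if u ∈ Q then c u else 0) else 1 - if u ∈ Q then c u else 0)
      = f J * ∏ u, if u ∈ Q then q u * (if u ∈ J then c u else 1 - c u)
        else (1 - q u) * (if u ∈ J then 0 else 1) := by
    intro Q
    rw [productWeight, mul_left_comm, ← Finset.prod_mul_distrib]
    congr 1
    refine Finset.prod_congr rfl fun u _ => ?_
    split_ifs <;> simp
  simp only [h, ← Finset.mul_sum, sum_prod_ite]
  congr 1
  refine Finset.prod_congr rfl fun u _ => ?_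
  split_ifs <;> ring

theorem sum_productWeight_mul_restrict (q c : α → ℝ) (u : α) :
    ∑ Q, productWeight q Q * (if u ∈ Q then c u else 0) = q u * c u := by
  -- The factor at `u` carries the restricted value, `c u` inside `Q` and `0` outside; every other
  -- coordinate sums to `1`.
  have := sum_prod_ite (fun v => if v = u then q v * c v else q v)
    (fun v => if v = u then 0 else 1 - q v)
  rw [← Finset.mul_prod_erase _ _ (Finset.mem_univ u)] at this
  rw [Finset.prod_congr rfl (g := fun _ => (1 : ℝ)) (s₁ := Finset.univ.erase u)
    (fun v hv => by simp [(Finset.mem_erase.1 hv).1])] at this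
  simp only [if_true, add_zero, Finset.prod_const_one, mul_one] at this
  rw [← this]
  refine Finset.sum_congr rfl fun Q _ => ?_
  rw [productWeight, ← Finset.mul_prod_erase _ _ (Finset.mem_univ u),
    ← Finset.mul_prod_erase _ _ (Finset.mem_univ u)]
  have e : ∏ v ∈ Finset.univ.erase u,
        (if v ∈ Q then if v = u then q v * c v else q v else if v = u then 0 else 1 - q v)
      = ∏ v ∈ Finset.univ.erase u, if v ∈ Q then q v else 1 - q v :=
    Finset.prod_congr rfl fun v hv => by simp [(Finset.mem_erase.1 hv).1]
  rw [e]
  by_cases h : u ∈ Q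
  · simp only [h, if_true]; ring
  · simp [h]

theorem expectedMultilinearExt_map (f : Finset α → ℝ) {m : ℕ} (q : α → ℝ)
    (hq : ∀ u, q u ∈ Set.Icc (0 : ℝ) 1) (φ : Finset α → Fin m → Finset α) :
    expectedMultilinearExt f ((productPMF q hq).map φ) =
      ∑ Q, productWeight q Q * multilinearExt f (avgVec (φ Q)) := by
  classical
  have h : ∀ S, (((productPMF q hq).map φ) S).toReal
      = ∑ Q, if S = φ Q then productWeight q Q else 0 := by
    intro S
    rw [PMF.map_apply, tsum_fintype, ENNReal.toReal_sum]
    · refine Finset.sum_congr rfl fun Q _ => ?_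
      split_ifs
      · exact ENNReal.toReal_ofReal (productWeight_nonneg hq Q)
      · rfl
    · intro Q _
      split_ifs
      · exact PMF.apply_ne_top _ _
      · simp
  simp only [expectedMultilinearExt, h, Finset.sum_mul]
  rw [Finset.sum_comm]
  refine Finset.sum_congr rfl fun Q _ => ?_
  simp [ite_mul]

end Multilinear

/-! ### Rounding a vector dominated by an average of independent sets. -/

section Rounding

variable {α : Type u} [DecidableEq α] [Fintype α]

/-- The number of the sets `B i` that contain `u`. -/
def coverCount {m : ℕ} (B : Fin m → Finset α) (u : α) : ℕ :=
  (Finset.univ.filter fun i => u ∈ B i).card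

omit [Fintype α] in
theorem avgVec_inter {m : ℕ} (B : Fin m → Finset α) (Q : Finset α) :
    avgVec (fun i => B i ∩ Q) = fun u => if u ∈ Q then (coverCount B u : ℝ) / m else 0 := by
  funext u
  by_cases h : u ∈ Q
  · simp [avgVec, charVec, coverCount, h, div_eq_inv_mul]
  · simp [avgVec, charVec, h]

/-- If the vector `x` is dominated by the average of the characteristic vectors of the sets `B i`,
these are the probabilities of keeping elements under which the average becomes `x` in
expectation. -/
noncomputable def keepProb {m : ℕ} (B : Fin m → Finset α) (x : α → ℝ) (u : α) : ℝ :=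
  x u / ((coverCount B u : ℝ) / m)

omit [Fintype α] in
theorem keepProb_mem_Icc {m : ℕ} {B : Fin m → Finset α} {x : α → ℝ} (h0 : ∀ u, 0 ≤ x u)
    (h1 : ∀ u, x u ≤ (coverCount B u : ℝ) / m) (u : α) : keepProb B x u ∈ Set.Icc (0 : ℝ) 1 :=
  ⟨div_nonneg (h0 u) (by positivity), div_le_one_of_le₀ (h1 u) (by positivity)⟩

omit [Fintype α] in
theorem keepProb_mul {m : ℕ} {B : Fin m → Finset α} {x : α → ℝ} (h0 : ∀ u, 0 ≤ x u)
    (h1 : ∀ u, x u ≤ (coverCount B u : ℝ) / m) (u : α) :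
    keepProb B x u * ((coverCount B u : ℝ) / m) = x u := by
  by_cases h : (coverCount B u : ℝ) / m = 0
  · have := h1 u
    rw [h] at this
    rw [h, mul_zero, le_antisymm this (h0 u)]
  · exact div_mul_cancel₀ _ h

/-- Rounding `x` to random subsets of the sets `B i` preserves the multilinear extension. -/
theorem expectedMultilinearExt_keepProb (f : Finset α → ℝ) {m : ℕ} {B : Fin m → Finset α}
    {x : α → ℝ} (h0 : ∀ u, 0 ≤ x u) (h1 : ∀ u, x u ≤ (coverCount B u : ℝ) / m) :
    expectedMultilinearExt f ((productPMF _ (keepProb_mem_Icc h0 h1)).map fun Q i => B i ∩ Q) =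
      multilinearExt f x := by
  rw [expectedMultilinearExt_map]
  simp only [avgVec_inter, sum_productWeight_mul_multilinearExt, keepProb_mul h0 h1]

/-- The polytope is down-closed: `x` is the expectation of the averages of the sets `B i ∩ Q`, which
are independent as subsets of `B i`. -/
theorem mem_matroidPolytope_of_le {M : Matroid α} {m : ℕ} (hm : m ≠ 0) {B : Fin m → Finset α}
    (hB : ∀ i, M.Indep (B i : Set α)) {x : α → ℝ} (h0 : ∀ u, 0 ≤ x u)
    (h1 : ∀ u, x u ≤ (coverCount B u : ℝ) / m) : x ∈ matroidPolytope M := by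
  have hx : x = ∑ Q, productWeight (keepProb B x) Q • avgVec fun i => B i ∩ Q := by
    funext u
    rw [Finset.sum_apply]
    simp only [Pi.smul_apply, smul_eq_mul, avgVec_inter]
    rw [sum_productWeight_mul_restrict _ (fun u => (coverCount B u : ℝ) / m),
      keepProb_mul h0 h1]
  rw [hx]
  refine (convex_convexHull ℝ _).sum_mem
    (fun Q _ => productWeight_nonneg (keepProb_mem_Icc h0 h1) Q) (sum_productWeight _)
    fun Q _ => ?_
  have ha : (avgVec fun i => B i ∩ Q) = ∑ i, (1 / (m : ℝ)) • charVec (B i ∩ Q) := by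
    funext u; simp [avgVec, Finset.mul_sum]
  rw [ha]
  refine (convex_convexHull ℝ _).sum_mem (fun i _ => by positivity) (by simp [hm]) fun i _ => ?_
  exact subset_convexHull ℝ _ ⟨_, (hB i).subset (by simp), rfl⟩

end Rounding

/-! ### The decreasing-threshold greedy split and its gain. -/

section Split

variable {α : Type u} [DecidableEq α] {ℓ : ℕ}

/-- The union of the pieces of a split. -/
def pieceUnion (T : Fin ℓ → Finset α) : Finset α := Finset.univ.biUnion T

theorem subset_pieceUnion (T : Fin ℓ → Finset α) (j : Fin ℓ) : T j ⊆ pieceUnion T :=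
  Finset.subset_biUnion_of_mem T (Finset.mem_univ j)

theorem pieceUnion_update (T : Fin ℓ → Finset α) (j : Fin ℓ) (u : α) :
    pieceUnion (Function.update T j (insert u (T j))) = insert u (pieceUnion T) := by
  ext x
  simp only [pieceUnion, Finset.mem_biUnion, Finset.mem_univ, true_and, Finset.mem_insert]
  constructor
  · rintro ⟨i, hi⟩
    by_cases h : i = j
    · subst h
      rw [Function.update_self, Finset.mem_insert] at hi
      exact hi.imp id fun h => ⟨_, h⟩
    · rw [Function.update_of_ne h] at hi
      exact Or.inr ⟨i, hi⟩
  · rintro (rfl | ⟨i, hi⟩)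
    · exact ⟨j, by simp⟩
    · refine ⟨i, ?_⟩
      by_cases h : i = j
      · subst h; simp [hi]
      · rwa [Function.update_of_ne h]

/-- The total gain of the pieces over the empty set. -/
def splitGain (g : Finset α → ℝ) (T : Fin ℓ → Finset α) : ℝ := ∑ j, (g (T j) - g ∅)

/-- Disjoint pieces with independent union, none of which is worse than the empty set. -/
structure IsSplit (M : Matroid α) (g : Finset α → ℝ) (T : Fin ℓ → Finset α) : Prop where
  indep : M.Indep (pieceUnion T : Set α)
  disjoint : Pairwise fun i j => Disjoint (T i) (T j)
  le : ∀ j, g ∅ ≤ g (T j)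

/-- `T'` extends `T`, gaining at least `τ` for each additional element. -/
structure SplitExtends (g : Finset α → ℝ) (τ : ℝ) (T T' : Fin ℓ → Finset α) : Prop where
  subset : ∀ j, T j ⊆ T' j
  gain : splitGain g T + τ * ((pieceUnion T').card - (pieceUnion T).card) ≤ splitGain g T'

theorem SplitExtends.refl (g : Finset α → ℝ) (τ : ℝ) (T : Fin ℓ → Finset α) :
    SplitExtends g τ T T := ⟨fun _ => subset_rfl, by simp⟩

theorem SplitExtends.trans {g : Finset α → ℝ} {τ : ℝ} {T T' T'' : Fin ℓ → Finset α}
    (h : SplitExtends g τ T T') (h' : SplitExtends g τ T' T'') : SplitExtends g τ T T'' :=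
  ⟨fun j => (h.subset j).trans (h'.subset j), by have := h.gain; have := h'.gain; linarith⟩

theorem SplitExtends.pieceUnion_subset {g : Finset α → ℝ} {τ : ℝ} {T T' : Fin ℓ → Finset α}
    (h : SplitExtends g τ T T') : pieceUnion T ⊆ pieceUnion T' :=
  Finset.biUnion_mono fun j _ => h.subset j

/-- The element is spanned by the split, or has marginal below the threshold for the piece. -/
def Exhausted (M : Matroid α) (g : Finset α → ℝ) (τ : ℝ) (T : Fin ℓ → Finset α)
    (p : α × Fin ℓ) : Prop :=
  p.1 ∈ M.closure (pieceUnion T) ∨ g (insert p.1 (T p.2)) - g (T p.2) < τ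

/-- Spans grow and marginals shrink, and an element that has entered the piece is spanned. Hence one
pass over all pairs suffices for each threshold. -/
theorem Exhausted.extend {M : Matroid α} (hE : M.E = Set.univ) {g : Finset α → ℝ}
    (hg : IsSubmodular g) {τ : ℝ} {T T' : Fin ℓ → Finset α} {p : α × Fin ℓ}
    (h : Exhausted M g τ T p) (hT : SplitExtends g τ T T') : Exhausted M g τ T' p := by
  rcases h with h | h
  · exact Or.inl (M.closure_subset_closure (by exact_mod_cast hT.pieceUnion_subset) h)
  · by_cases hp : p.1 ∈ T' p.2
    · exact Or.inl (M.mem_closure_of_mem (by exact_mod_cast subset_pieceUnion T' p.2 hp)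
        (by simp [hE]))
    · exact Or.inr ((hg.insert_sub_le (hT.subset p.2) p.1 fun h => absurd h hp).trans_lt h)

open Classical in
/-- Add the element to the piece if this keeps the union independent and gains at least `τ`. -/
noncomputable def augment (M : Matroid α) (g : Finset α → ℝ) (τ : ℝ) (T : Fin ℓ → Finset α)
    (p : α × Fin ℓ) : Fin ℓ → Finset α :=
  if p.1 ∉ pieceUnion T ∧ M.Indep ((insert p.1 (pieceUnion T) : Finset α) : Set α) ∧
      τ ≤ g (insert p.1 (T p.2)) - g (T p.2)
  then Function.update T p.2 (insert p.1 (T p.2)) else T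

theorem augment_spec {M : Matroid α} (hE : M.E = Set.univ) {g : Finset α → ℝ} {τ : ℝ}
    (hτ : 0 ≤ τ) {T : Fin ℓ → Finset α} (hT : IsSplit M g T) (p : α × Fin ℓ) :
    IsSplit M g (augment M g τ T p) ∧ SplitExtends g τ T (augment M g τ T p) ∧
      Exhausted M g τ (augment M g τ T p) p := by
  obtain ⟨u, j⟩ := p
  unfold augment
  split_ifs with h
  · obtain ⟨hu, hind, hgain⟩ := h
    simp only at hu hind hgain ⊢
    have hne : ∀ i, i ≠ j → Disjoint (insert u (T j)) (T i) := fun i hi =>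
      Finset.disjoint_insert_left.2
        ⟨fun h => hu (subset_pieceUnion T i h), hT.disjoint hi.symm⟩
    refine ⟨⟨by rwa [pieceUnion_update], ?_, ?_⟩, ⟨?_, ?_⟩, ?_⟩
    · intro i k hik
      simp only [Function.update_apply]
      split_ifs with h1 h2 h2
      · exact absurd (h1.trans h2.symm) hik
      · exact hne k h2
      · exact (hne i h1).symm
      · exact hT.disjoint hik
    · intro i
      by_cases h : i = j
      · subst h
        rw [Function.update_self]
        have := hT.le i
        linarith
      · rw [Function.update_of_ne h]; exact hT.le i
    · intro i
      by_cases h : i = j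
      · subst h
        rw [Function.update_self]
        exact Finset.subset_insert _ _
      · rw [Function.update_of_ne h]
    · rw [pieceUnion_update, Finset.card_insert_of_notMem hu, splitGain, splitGain,
        ← Finset.add_sum_erase _ _ (Finset.mem_univ j),
        ← Finset.add_sum_erase _ _ (Finset.mem_univ j), Function.update_self,
        Finset.sum_congr rfl (g := fun i => g (T i) - g ∅) (s₁ := Finset.univ.erase j)
          (s₂ := Finset.univ.erase j) (f := fun i => g (Function.update T j _ i) - g ∅)
          fun i hi => by rw [Function.update_of_ne (Finset.ne_of_mem_erase hi)]]
      push_cast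
      linarith
    · left
      rw [pieceUnion_update]
      exact M.mem_closure_of_mem (by simp) (by simp [hE])
  · refine ⟨hT, .refl _ _ _, ?_⟩
    by_contra hex
    simp only [Exhausted, not_or, not_lt] at hex
    refine h ⟨fun hu => hex.1 (M.mem_closure_of_mem (by exact_mod_cast hu) (by simp [hE])), ?_,
      hex.2⟩
    by_contra hdep
    refine hex.1 (hT.indep.mem_closure_iff.2 (Or.inl ?_))
    rw [← Matroid.not_indep_iff (by simp [hE])]
    simpa using hdep

theorem foldl_augment_spec {M : Matroid α} (hE : M.E = Set.univ) {g : Finset α → ℝ}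
    (hg : IsSubmodular g) {τ : ℝ} (hτ : 0 ≤ τ) (l : List (α × Fin ℓ)) {T : Fin ℓ → Finset α}
    (hT : IsSplit M g T) :
    IsSplit M g (l.foldl (augment M g τ) T) ∧ SplitExtends g τ T (l.foldl (augment M g τ) T) ∧
      ∀ p ∈ l, Exhausted M g τ (l.foldl (augment M g τ) T) p := by
  induction l generalizing T with
  | nil => exact ⟨hT, .refl _ _ _, by simp⟩
  | cons p l ih =>
    obtain ⟨h1, h2, h3⟩ := augment_spec hE hτ hT p
    obtain ⟨k1, k2, k3⟩ := ih h1
    refine ⟨k1, h2.trans k2, ?_⟩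
    simp only [List.mem_cons, forall_eq_or_imp, List.foldl_cons]
    exact ⟨h3.extend hE hg k2, k3⟩

/-- The excess over `σ` of the positive marginals of an independent set is paid for by the gain. -/
def ExcessBounded (M : Matroid α) (g : Finset α → ℝ) (q σ : ℝ) (T : Fin ℓ → Finset α) : Prop :=
  ∀ (O : Finset α) (j : Fin ℓ) (v : α → ℝ), M.Indep (O : Set α) →
    (∀ o ∈ O, v o ≤ max 0 (g (insert o (T j)) - g (T j))) →
    ∑ o ∈ O, max (v o - σ) 0 ≤ splitGain g T / q - σ * (pieceUnion T).card

omit [DecidableEq α] in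
theorem card_le_of_subset_closure {M : Matroid α} {O B : Finset α} (hO : M.Indep (O : Set α))
    (h : ∀ o ∈ O, o ∈ M.closure B) : O.card ≤ B.card := by
  have h1 : (O : Set α).encard ≤ (B : Set α).encard := by
    calc (O : Set α).encard = M.eRk O := hO.eRk_eq_encard.symm
      _ ≤ M.eRk (M.closure B) := M.eRk_mono fun o ho => h o ho
      _ = M.eRk B := M.eRk_closure_eq _
      _ ≤ (B : Set α).encard := M.eRk_le_encard _
  simpa [Set.encard_coe_eq_coe_finsetCard] using h1

variable [Fintype α]

/-- All pairs of an element and a piece. -/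
noncomputable def allPairs (α : Type u) [Fintype α] (ℓ : ℕ) : List (α × Fin ℓ) :=
  (Finset.univ : Finset (α × Fin ℓ)).toList

/-- Lowering the threshold from `σ` to `q * σ` raises an excess by at most `σ - q * σ`, and only for
elements with `v o > q * σ`. These are all spanned by the new union, so they number at most its
size. Every added element gained at least `q * σ`, that is `σ` after division by `q`, and this pays
for the larger union. -/
theorem ExcessBounded.pass {M : Matroid α} (hE : M.E = Set.univ) {g : Finset α → ℝ}
    (hg : IsSubmodular g) {q σ : ℝ} (hq0 : 0 < q) (hq1 : q ≤ 1) (hσ : 0 ≤ σ)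
    {T : Fin ℓ → Finset α} (hT : IsSplit M g T) (h : ExcessBounded M g q σ T) :
    ExcessBounded M g q (q * σ) ((allPairs α ℓ).foldl (augment M g (q * σ)) T) := by
  intro O j v hO hv
  have hqσ : 0 ≤ q * σ := by positivity
  have hle : q * σ ≤ σ := mul_le_of_le_one_left hσ hq1
  obtain ⟨-, h2, h3⟩ := foldl_augment_spec hE hg hqσ (allPairs α ℓ) hT
  set T' := (allPairs α ℓ).foldl (augment M g (q * σ)) T
  -- The invariant is quantified over all `v` below the positive part of the marginals precisely so
  -- that it can be applied to the old split with the bounds for the new one. An element already in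
  -- the new piece has `v o ≤ 0`.
  have hv' : ∀ o ∈ O, v o ≤ max 0 (g (insert o (T j)) - g (T j)) := by
    intro o ho
    by_cases hoT : o ∈ T' j
    · have := hv o ho
      rw [Finset.insert_eq_of_mem hoT, sub_self, max_self] at this
      exact this.trans (le_max_left _ _)
    · exact (hv o ho).trans
        (max_le_max le_rfl (hg.insert_sub_le (h2.subset j) o fun h => absurd h hoT))
  have hcard : (O.filter fun o => q * σ < v o).card ≤ (pieceUnion T').card := by
    refine card_le_of_subset_closure (M := M)
      (hO.subset (by simp only [Finset.coe_subset]; exact Finset.filter_subset _ _)) fun o ho => ?_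
    obtain ⟨hoO, ho⟩ := Finset.mem_filter.1 ho
    refine (h3 (o, j) (by simp [allPairs])).resolve_right fun hlt => ?_
    have := (hv o hoO).trans (max_le hqσ hlt.le)
    linarith
  have hcard' : ((O.filter fun o => q * σ < v o).card : ℝ) ≤ (pieceUnion T').card := by
    exact_mod_cast hcard
  have hsum : ∑ o ∈ O, max (v o - q * σ) 0 ≤
      ∑ o ∈ O, max (v o - σ) 0 + (σ - q * σ) * (O.filter fun o => q * σ < v o).card := by
    rw [Finset.card_filter, Nat.cast_sum, Finset.mul_sum, ← Finset.sum_add_distrib]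
    refine Finset.sum_le_sum fun o _ => ?_
    have hm := le_max_left (v o - σ) 0
    have hm' := le_max_right (v o - σ) 0
    split_ifs with hlt
    · push_cast
      exact max_le (by linarith) (by linarith)
    · push_cast
      exact max_le (by linarith) (by linarith)
  have hgain := h2.gain
  have hdiv : splitGain g T / q + σ * ((pieceUnion T').card - (pieceUnion T).card)
      ≤ splitGain g T' / q := by
    rw [le_div_iff₀ hq0, add_mul, div_mul_cancel₀ _ hq0.ne']
    linarith
  have := h O j v hO hv'
  have := mul_le_mul_of_nonneg_left hcard' (sub_nonneg.2 hle)
  linarith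

/-- The decreasing-threshold greedy split. -/
noncomputable def greedySplit (ℓ : ℕ) (M : Matroid α) (g : Finset α → ℝ) (q W : ℝ) (K : ℕ) :
    Fin ℓ → Finset α :=
  (List.range K).foldl (fun T k => (allPairs α ℓ).foldl (augment M g (W * q ^ (k + 1))) T)
    fun _ => ∅

theorem greedySplit_succ (ℓ : ℕ) (M : Matroid α) (g : Finset α → ℝ) (q W : ℝ) (K : ℕ) :
    greedySplit ℓ M g q W (K + 1) =
      (allPairs α ℓ).foldl (augment M g (W * q ^ (K + 1))) (greedySplit ℓ M g q W K) := by
  simp [greedySplit, List.range_succ]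

theorem greedySplit_spec {M : Matroid α} (hE : M.E = Set.univ) {g : Finset α → ℝ}
    (hg : IsSubmodular g) {q W : ℝ} (hq0 : 0 < q) (hq1 : q ≤ 1) (hW0 : 0 ≤ W)
    (hW : ∀ u, M.Indep {u} → g {u} - g ∅ ≤ W) (ℓ K : ℕ) :
    IsSplit M g (greedySplit ℓ M g q W K) ∧
      ExcessBounded M g q (W * q ^ K) (greedySplit ℓ M g q W K) := by
  induction K with
  | zero =>
    have h0 : pieceUnion (fun _ : Fin ℓ => (∅ : Finset α)) = ∅ := by
      ext; simp [pieceUnion]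
    have e : greedySplit ℓ M g q W 0 = fun _ => ∅ := rfl
    rw [e]
    refine ⟨⟨by rw [h0]; simp, fun i j _ => by simp, fun j => le_rfl⟩, ?_⟩
    intro O j v hO hv
    rw [h0]
    simp only [pow_zero, mul_one, splitGain, sub_self, Finset.sum_const_zero, zero_div,
      Finset.card_empty, Nat.cast_zero, mul_zero]
    refine Finset.sum_nonpos fun o ho => max_le ?_ le_rfl
    have := (hv o ho).trans (max_le hW0 (hW o (hO.subset (by simpa using ho))))
    linarith
  | succ K ih =>
    have hs : W * q ^ (K + 1) = q * (W * q ^ K) := by ring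
    have hσ : 0 ≤ W * q ^ K := by positivity
    rw [greedySplit_succ, hs]
    exact ⟨(foldl_augment_spec hE hg (by positivity) _ ih.1).1, ih.2.pass hE hg hq0 hq1 hσ ih.1⟩

omit [Fintype α] in
theorem splitGain_nonneg {M : Matroid α} {g : Finset α → ℝ} {T : Fin ℓ → Finset α}
    (hT : IsSplit M g T) : 0 ≤ splitGain g T :=
  Finset.sum_nonneg fun j _ => sub_nonneg.2 (hT.le j)

-- Submodularity bounds the left side by the sum of the single marginals, and each marginal is at
-- most `σ` plus its excess over `σ`.
omit [Fintype α] in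
theorem ExcessBounded.union_sub_le {M : Matroid α} {g : Finset α → ℝ} (hg : IsSubmodular g)
    {q σ : ℝ} (hσ : 0 ≤ σ) {T : Fin ℓ → Finset α} (h : ExcessBounded M g q σ T)
    {O : Finset α} (hO : M.Indep (O : Set α)) (j : Fin ℓ) :
    g (O ∪ T j) - g (T j) ≤ splitGain g T / q + O.card * σ := by
  have h1 := h O j (fun o => g (insert o (T j)) - g (T j)) hO fun o _ => le_max_right _ _
  have h2 : ∑ o ∈ O, (g (insert o (T j)) - g (T j)) ≤
      ∑ o ∈ O, (max (g (insert o (T j)) - g (T j) - σ) 0 + σ) :=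
    Finset.sum_le_sum fun o _ => by
      have := le_max_left (g (insert o (T j)) - g (T j) - σ) 0
      linarith
  rw [Finset.sum_add_distrib, Finset.sum_const, nsmul_eq_mul] at h2
  have h3 := hg.union_sub_le_sum O (T j)
  have h4 : 0 ≤ σ * (pieceUnion T).card := by positivity
  linarith

/-- The average, over the pieces, of the value of adding the piece to `O`. -/
noncomputable def avgUnion (g : Finset α → ℝ) (T : Fin ℓ → Finset α) (O : Finset α) : ℝ :=
  (∑ j, g (O ∪ T j)) / ℓ

-- Averaging the hypothesis over the pieces, the mean of `g (T j)` is `g ∅ + splitGain g T / ℓ`;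
-- this is the origin of the term `1 / ℓ`.
omit [Fintype α] in
theorem avgUnion_sub_le {g : Finset α → ℝ} {T : Fin ℓ → Finset α} {O : Finset α} (hℓ : ℓ ≠ 0)
    {q e : ℝ} (h : ∀ j, g (O ∪ T j) - g (T j) ≤ splitGain g T / q + e) :
    avgUnion g T O - g ∅ - e ≤ (1 / q + 1 / ℓ) * splitGain g T := by
  have hs := Finset.sum_le_sum fun j (_ : j ∈ (Finset.univ : Finset (Fin ℓ))) => h j
  have hG : splitGain g T = ∑ j, g (T j) - ℓ * g ∅ := by simp [splitGain]
  rw [Finset.sum_sub_distrib, Finset.sum_const, Finset.card_univ, Fintype.card_fin,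
    nsmul_eq_mul] at hs
  have hℓ' : (0 : ℝ) < ℓ := by positivity
  have : avgUnion g T O ≤ (ℓ * (splitGain g T / q + e) + splitGain g T + ℓ * g ∅) / ℓ := by
    unfold avgUnion
    gcongr
    linarith
  have e2 : (ℓ * (splitGain g T / q + e) + splitGain g T + ℓ * g ∅) / ℓ
      = splitGain g T / q + e + splitGain g T / ℓ + g ∅ := by
    field_simp
  rw [e2] at this
  have e3 : (1 / q + 1 / ℓ) * splitGain g T = splitGain g T / q + splitGain g T / ℓ := by ring
  linarith

omit [Fintype α] in
theorem IsSplit.pairwise_ofFn {M : Matroid α} {g : Finset α → ℝ} {T : Fin ℓ → Finset α}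
    (hT : IsSplit M g T) : (List.ofFn T).Pairwise Disjoint :=
  List.pairwise_ofFn.2 fun _ _ h => hT.disjoint h.ne

-- A single piece may destroy the value of `O` when `g` is not monotone, but disjoint pieces cannot
-- all do so. This is why a split has several pieces.
omit [Fintype α] in
theorem le_avgUnion {M : Matroid α} {g : Finset α → ℝ} (hg : IsSubmodular g)
    (hg0 : ∀ S, 0 ≤ g S) {T : Fin ℓ → Finset α} (hT : IsSplit M g T) (hℓ : ℓ ≠ 0)
    (O : Finset α) : (1 - 1 / ℓ) * g O ≤ avgUnion g T O := by
  have h := hg.sum_disjoint_ge hT.pairwise_ofFn O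
  rw [List.map_ofFn, List.sum_ofFn, List.length_ofFn] at h
  have h0 := hg0 ((List.ofFn T).foldr (· ∪ ·) ∅ ∪ O)
  simp only [Function.comp_apply, Finset.union_comm _ O] at h h0
  have hℓ' : (0 : ℝ) < ℓ := by positivity
  rw [avgUnion, le_div_iff₀ hℓ']
  have : (1 - 1 / (ℓ : ℝ)) * g O * ℓ = (ℓ - 1) * g O := by field_simp
  linarith

omit [Fintype α] in
theorem le_avgUnion_of_monotone {g : Finset α → ℝ} (hg : Monotone g) (T : Fin ℓ → Finset α)
    (hℓ : ℓ ≠ 0) (O : Finset α) : g O ≤ avgUnion g T O := by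
  have hℓ' : (0 : ℝ) < ℓ := by positivity
  rw [avgUnion, le_div_iff₀ hℓ']
  have := Finset.card_nsmul_le_sum (Finset.univ : Finset (Fin ℓ)) (fun j => g (O ∪ T j)) (g O)
    fun j _ => hg Finset.subset_union_left
  rw [Finset.card_univ, Fintype.card_fin, nsmul_eq_mul] at this
  linarith

omit [Fintype α] in
/-- The increase of the expectation when the pieces of a split are added with probability `δ`. -/
theorem IsSplit.le_randUnion {M : Matroid α} {g : Finset α → ℝ} (hg : IsSubmodular g)
    (hg0 : ∀ S, 0 ≤ g S) {T : Fin ℓ → Finset α} (hT : IsSplit M g T) (hℓ : ℓ ≠ 0) {δ η q e : ℝ}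
    (hδ0 : 0 ≤ δ) (hδ1 : δ ≤ 1) (hη : 0 ≤ η) (hq : 1 / q ≤ 1 + η)
    (hρ : 1 / (ℓ : ℝ) + η + ℓ * δ ≤ 1)
    {O : Finset α} (h : ∀ j, g (O ∪ T j) - g (T j) ≤ splitGain g T / q + e) :
    (1 - δ) * g ∅ + δ * ((1 - (1 / ℓ + η + ℓ * δ)) * (avgUnion g T O - e)) ≤
      randUnion δ g (List.ofFn T) ∅ := by
  have h1 := hg.add_gain_le_randUnion hδ0 hδ1 hg0 hT.pairwise_ofFn (by
    intro U hU
    obtain ⟨j, rfl⟩ := (List.mem_ofFn' T U).1 hU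
    exact hT.le j)
  rw [List.map_ofFn, List.sum_ofFn, List.length_ofFn] at h1
  have h2 := avgUnion_sub_le hℓ h
  have hG := splitGain_nonneg hT
  have hG' : ∑ i, ((fun S => g S - g ∅) ∘ T) i = splitGain g T := rfl
  rw [hG'] at h1
  set G := splitGain g T
  set X := avgUnion g T O - g ∅ - e with hX
  have hℓ' : (0 : ℝ) < 1 / ℓ := by positivity
  set θ := (ℓ : ℝ) * δ with hθ
  have hθ0 : 0 ≤ θ := by positivity
  set s := 1 / (ℓ : ℝ)
  -- When `X ≥ 0`, the factor `1 + (s + η)` is inverted through `(1 - x) * (1 + x) ≤ 1`, and then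
  -- `(1 - θ) * (1 - (s + η)) ≥ 1 - (s + η + θ)`.
  have key : (1 - (s + η + θ)) * X ≤ (1 - θ) * G := by
    rcases le_total X 0 with hX0 | hX0
    · exact (mul_nonpos_of_nonneg_of_nonpos (by linarith) hX0).trans
        (mul_nonneg (by linarith) hG)
    · have h3 : X ≤ (1 + (s + η)) * G := by
        refine h2.trans (mul_le_mul_of_nonneg_right ?_ hG)
        linarith
      have h4 : (1 - (s + η)) * X ≤ G := by
        have := mul_le_mul_of_nonneg_left h3 (show 0 ≤ 1 - (s + η) by linarith)
        nlinarith [mul_nonneg (sq_nonneg (s + η)) hG]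
      have h5 := mul_le_mul_of_nonneg_left h4 (show 0 ≤ 1 - θ by linarith)
      nlinarith [mul_nonneg (mul_nonneg hθ0 (show 0 ≤ s + η by linarith)) hX0]
  have e1 : avgUnion g T O - e = X + g ∅ := by rw [hX]; ring
  rw [e1]
  refine le_trans ?_ h1
  have h6 := mul_le_mul_of_nonneg_left key hδ0
  have h7 : 0 ≤ δ * ((s + η) * g ∅) := by
    have := hg0 ∅
    positivity
  nlinarith

end Split

/-! ### A base, giving the rank, and the best independent singleton. -/

section Setup

variable {α : Type u} [DecidableEq α]

open Classical in
/-- Extend an independent set greedily, and track the largest value of an independent singleton. -/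
noncomputable def setupStep (M : Matroid α) (f : Finset α → ℝ) (s : Finset α × ℝ) (u : α) :
    Finset α × ℝ :=
  (if M.Indep ((insert u s.1 : Finset α) : Set α) then insert u s.1 else s.1,
    if M.Indep (({u} : Finset α) : Set α) then max s.2 (f {u}) else s.2)

theorem foldl_setupStep_fst {M : Matroid α} (hE : M.E = Set.univ) (f : Finset α → ℝ) (l : List α)
    (s : Finset α × ℝ) (hs : M.Indep (s.1 : Set α)) :
    M.Indep ((l.foldl (setupStep M f) s).1 : Set α) ∧ s.1 ⊆ (l.foldl (setupStep M f) s).1 ∧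
      ∀ u ∈ l, u ∈ M.closure (l.foldl (setupStep M f) s).1 := by
  induction l generalizing s with
  | nil => simp [hs]
  | cons u l ih =>
    have h : M.Indep ((setupStep M f s u).1 : Set α) ∧ s.1 ⊆ (setupStep M f s u).1 ∧
        u ∈ M.closure (setupStep M f s u).1 := by
      simp only [setupStep]
      split_ifs with hi
      · exact ⟨hi, Finset.subset_insert _ _, M.mem_closure_of_mem (by simp) (by simp [hE])⟩
      · refine ⟨hs, subset_rfl, hs.mem_closure_iff.2 (Or.inl ?_)⟩
        rw [← Matroid.not_indep_iff (by simp [hE])]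
        simpa using hi
    obtain ⟨k1, k2, k3⟩ := ih _ h.1
    refine ⟨k1, h.2.1.trans k2, ?_⟩
    simp only [List.mem_cons, forall_eq_or_imp, List.foldl_cons]
    exact ⟨M.closure_subset_closure (by exact_mod_cast k2) h.2.2, k3⟩

/-- The last clause is applied with `D` the optimal value, so that errors relative to the best
singleton are errors relative to the optimum. -/
theorem foldl_setupStep_snd {M : Matroid α} (f : Finset α → ℝ) (l : List α) (s : Finset α × ℝ) :
    s.2 ≤ (l.foldl (setupStep M f) s).2 ∧
      (∀ u ∈ l, M.Indep {u} → f {u} ≤ (l.foldl (setupStep M f) s).2) ∧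
      ∀ D, s.2 ≤ D → (∀ u, M.Indep {u} → f {u} ≤ D) → (l.foldl (setupStep M f) s).2 ≤ D := by
  induction l generalizing s with
  | nil => exact ⟨le_rfl, by simp, fun D h _ => h⟩
  | cons u l ih =>
    obtain ⟨k1, k2, k3⟩ := ih (setupStep M f s u)
    have h1 : s.2 ≤ (setupStep M f s u).2 := by
      simp only [setupStep]
      split_ifs
      · exact le_max_left _ _
      · exact le_rfl
    refine ⟨h1.trans k1, ?_, ?_⟩
    · simp only [List.mem_cons, forall_eq_or_imp, List.foldl_cons]
      refine ⟨fun hu => le_trans ?_ k1, k2⟩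
      simp [setupStep, hu]
    · intro D hD hu
      refine k3 D ?_ hu
      simp only [setupStep]
      split_ifs with hi
      · exact max_le hD (hu u (by simpa using hi))
      · exact hD

variable [Fintype α]

/-- A base and the largest value of an independent singleton. -/
noncomputable def setup (M : Matroid α) (f : Finset α → ℝ) : Finset α × ℝ :=
  (Finset.univ : Finset α).toList.foldl (setupStep M f) (∅, 0)

theorem setup_isBase {M : Matroid α} (hE : M.E = Set.univ) (f : Finset α → ℝ) :
    M.IsBase ((setup M f).1 : Set α) := by
  obtain ⟨h1, -, h3⟩ := foldl_setupStep_fst hE f (Finset.univ : Finset α).toList (∅, 0) (by simp)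
  exact h1.isBase_of_ground_subset_closure fun u _ => h3 u (by simp)

theorem setup_card {M : Matroid α} (hE : M.E = Set.univ) (f : Finset α → ℝ) :
    (setup M f).1.card = M.eRank.toNat := by
  rw [← (setup_isBase hE f).encard_eq_eRank, Set.encard_coe_eq_coe_finsetCard]; rfl

theorem card_le_setup_card {M : Matroid α} (hE : M.E = Set.univ) (f : Finset α → ℝ)
    {O : Finset α} (hO : M.Indep (O : Set α)) : O.card ≤ (setup M f).1.card := by
  have := hO.encard_le_eRank
  rw [← (setup_isBase hE f).encard_eq_eRank] at this
  simpa [Set.encard_coe_eq_coe_finsetCard] using this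

end Setup

/-! ### Oracle implementations and their query counts. -/

namespace OracleAlg

section Algorithms

variable {α : Type u} [DecidableEq α] {ℓ : ℕ}

/-- The oracle version of `augment`. -/
noncomputable def augmentAlg (δ : ℝ) (L : List (Finset α)) (τ : ℝ) (T : Fin ℓ → Finset α)
    (p : α × Fin ℓ) : OracleAlg α (Fin ℓ → Finset α) :=
  if p.1 ∈ pieceUnion T then ret T else
    indep (insert p.1 (pieceUnion T)) fun b =>
      if b then
        (evalUnion δ L (insert p.1 (T p.2))).bind fun x => (evalUnion δ L (T p.2)).bind fun y =>
          ret (if τ ≤ x - y then Function.update T p.2 (insert p.1 (T p.2)) else T)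
      else ret T

theorem run_augmentAlg (M : Matroid α) (f : Finset α → ℝ) (δ : ℝ) (L : List (Finset α)) (τ : ℝ)
    (T : Fin ℓ → Finset α) (p : α × Fin ℓ) :
    (augmentAlg δ L τ T p).run M f = augment M (randUnion δ f L) τ T p := by
  unfold augmentAlg augment
  by_cases h1 : p.1 ∈ pieceUnion T
  · simp [h1, run]
  · by_cases h2 : M.Indep ((insert p.1 (pieceUnion T) : Finset α) : Set α)
    · simp only [h1, h2, if_false, run, decide_true, if_true, run_bind, run_evalUnion,
        not_false_eq_true, true_and]
    · simp only [h1, h2, if_false, run, decide_false, not_false_eq_true, true_and, false_and,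
        Bool.false_eq_true]

theorem valueQueries_augmentAlg_le (M : Matroid α) (f : Finset α → ℝ) (δ : ℝ)
    (L : List (Finset α)) (τ : ℝ) (T : Fin ℓ → Finset α) (p : α × Fin ℓ) :
    (augmentAlg δ L τ T p).valueQueries M f ≤ 2 * 2 ^ L.length := by
  unfold augmentAlg
  split_ifs
  · simp [valueQueries]
  · simp only [valueQueries]
    split_ifs
    · simp only [valueQueries_bind, valueQueries_evalUnion, valueQueries]; omega
    · simp [valueQueries]

theorem indepQueries_augmentAlg_le (M : Matroid α) (f : Finset α → ℝ) (δ : ℝ)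
    (L : List (Finset α)) (τ : ℝ) (T : Fin ℓ → Finset α) (p : α × Fin ℓ) :
    (augmentAlg δ L τ T p).indepQueries M f ≤ 1 := by
  unfold augmentAlg
  split_ifs
  · simp [indepQueries]
  · simp only [indepQueries]
    split_ifs
    · simp only [indepQueries_bind, indepQueries_evalUnion, indepQueries]; omega
    · simp [indepQueries]

variable [Fintype α]

/-- The oracle version of `greedySplit`. -/
noncomputable def splitAlg (ℓ : ℕ) (δ : ℝ) (L : List (Finset α)) (q W : ℝ) (K : ℕ) :
    OracleAlg α (Fin ℓ → Finset α) :=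
  fold (fun k T => fold (fun p T => augmentAlg δ L (W * q ^ (k + 1)) T p) (allPairs α ℓ) T)
    (List.range K) fun _ => ∅

theorem run_splitAlg (M : Matroid α) (f : Finset α → ℝ) (ℓ : ℕ) (δ : ℝ) (L : List (Finset α))
    (q W : ℝ) (K : ℕ) :
    (splitAlg ℓ δ L q W K).run M f = greedySplit ℓ M (randUnion δ f L) q W K := by
  simp only [splitAlg, run_fold, run_augmentAlg]; rfl

omit [DecidableEq α] in
theorem length_allPairs (ℓ : ℕ) : (allPairs α ℓ).length = Fintype.card α * ℓ := by
  simp [allPairs]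

theorem valueQueries_splitAlg_le (M : Matroid α) (f : Finset α → ℝ) (ℓ : ℕ) (δ : ℝ)
    (L : List (Finset α)) (q W : ℝ) (K : ℕ) :
    (splitAlg ℓ δ L q W K).valueQueries M f ≤
      K * (Fintype.card α * ℓ * (2 * 2 ^ L.length)) := by
  have := valueQueries_fold_le M f (fun k T => fold (fun p T => augmentAlg δ L
    (W * q ^ (k + 1)) T p) (allPairs α ℓ) T) (Fintype.card α * ℓ * (2 * 2 ^ L.length))
    (fun k T => by
      rw [← length_allPairs]
      exact valueQueries_fold_le M f _ _
        (fun p T => valueQueries_augmentAlg_le M f δ L _ T p) _ _) (List.range K) fun _ => ∅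
  rwa [List.length_range] at this

theorem indepQueries_splitAlg_le (M : Matroid α) (f : Finset α → ℝ) (ℓ : ℕ) (δ : ℝ)
    (L : List (Finset α)) (q W : ℝ) (K : ℕ) :
    (splitAlg ℓ δ L q W K).indepQueries M f ≤ K * (Fintype.card α * ℓ * 1) := by
  have := indepQueries_fold_le M f (fun k T => fold (fun p T => augmentAlg δ L
    (W * q ^ (k + 1)) T p) (allPairs α ℓ) T) (Fintype.card α * ℓ * 1)
    (fun k T => by
      rw [← length_allPairs]
      exact indepQueries_fold_le M f _ _
        (fun p T => indepQueries_augmentAlg_le M f δ L _ T p) _ _) (List.range K) fun _ => ∅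
  rwa [List.length_range] at this

/-- The list of all pieces of a list of splits. -/
def _root_.allPieces {α : Type u} {ℓ : ℕ} (H : List (Fin ℓ → Finset α)) : List (Finset α) :=
  H.flatMap List.ofFn

omit [DecidableEq α] [Fintype α] in
theorem _root_.length_allPieces (H : List (Fin ℓ → Finset α)) :
    (allPieces H).length = H.length * ℓ := by
  induction H with
  | nil => simp [allPieces]
  | cons T H ih =>
    simp only [allPieces, List.flatMap_cons, List.length_append, List.length_ofFn,
      List.length_cons] at ih ⊢
    rw [ih]; ring

/-- Iterated splitting: each split is computed with respect to the random union of the pieces of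
the previous ones. -/
noncomputable def _root_.iteratedSplit (ℓ : ℕ) (M : Matroid α) (f : Finset α → ℝ) (δ q W : ℝ)
    (K : ℕ) : ℕ → List (Fin ℓ → Finset α)
  | 0 => []
  | i + 1 => greedySplit ℓ M (randUnion δ f (allPieces (iteratedSplit ℓ M f δ q W K i))) q W K ::
      iteratedSplit ℓ M f δ q W K i

theorem _root_.length_iteratedSplit (M : Matroid α) (f : Finset α → ℝ) (δ q W : ℝ) (K i : ℕ) :
    (iteratedSplit ℓ M f δ q W K i).length = i := by
  induction i with
  | zero => rfl
  | succ i ih => simp [iteratedSplit, ih]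

/-- The oracle version of `iteratedSplit`. -/
noncomputable def iteratedAlg (ℓ : ℕ) (δ q W : ℝ) (K : ℕ) :
    ℕ → OracleAlg α (List (Fin ℓ → Finset α))
  | 0 => ret []
  | i + 1 => (iteratedAlg ℓ δ q W K i).bind fun H =>
      (splitAlg ℓ δ (allPieces H) q W K).bind fun T => ret (T :: H)

theorem run_iteratedAlg (M : Matroid α) (f : Finset α → ℝ) (δ q W : ℝ) (K i : ℕ) :
    (iteratedAlg ℓ δ q W K i).run M f = iteratedSplit ℓ M f δ q W K i := by
  induction i with
  | zero => rfl
  | succ i ih => simp only [iteratedAlg, run_bind, run_splitAlg, ih, run, iteratedSplit]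

theorem valueQueries_iteratedAlg_le (M : Matroid α) (f : Finset α → ℝ) (δ q W : ℝ)
    (K m i : ℕ) (hi : i ≤ m) :
    (iteratedAlg ℓ δ q W K i).valueQueries M f ≤
      i * (K * (Fintype.card α * ℓ * (2 * 2 ^ (m * ℓ)))) := by
  induction i with
  | zero => simp [iteratedAlg, valueQueries]
  | succ i ih =>
    have h1 := ih (by omega)
    have h2 := valueQueries_splitAlg_le M f ℓ δ (allPieces (iteratedSplit ℓ M f δ q W K i)) q W K
    rw [length_allPieces, length_iteratedSplit] at h2
    have h3 : K * (Fintype.card α * ℓ * (2 * 2 ^ (i * ℓ))) ≤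
        K * (Fintype.card α * ℓ * (2 * 2 ^ (m * ℓ))) := by
      gcongr
      · norm_num
      · omega
    simp only [iteratedAlg, valueQueries_bind, run_iteratedAlg, valueQueries]
    linarith

theorem indepQueries_iteratedAlg_le (M : Matroid α) (f : Finset α → ℝ) (δ q W : ℝ)
    (K i : ℕ) :
    (iteratedAlg ℓ δ q W K i).indepQueries M f ≤ i * (K * (Fintype.card α * ℓ * 1)) := by
  induction i with
  | zero => simp [iteratedAlg, indepQueries]
  | succ i ih =>
    have h2 := indepQueries_splitAlg_le M f ℓ δ (allPieces (iteratedSplit ℓ M f δ q W K i)) q W K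
    simp only [iteratedAlg, indepQueries_bind, run_iteratedAlg, indepQueries]
    linarith

/-- The oracle version of `setupStep`. -/
noncomputable def setupStepAlg (u : α) (s : Finset α × ℝ) : OracleAlg α (Finset α × ℝ) :=
  indep (insert u s.1) fun b => indep {u} fun b' => value {u} fun x =>
    ret (if b then insert u s.1 else s.1, if b' then max s.2 x else s.2)

omit [Fintype α] in
theorem run_setupStepAlg (M : Matroid α) (f : Finset α → ℝ) (u : α) (s : Finset α × ℝ) :
    (setupStepAlg u s).run M f = setupStep M f s u := by
  by_cases h : M.Indep ((insert u s.1 : Finset α) : Set α) <;>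
    by_cases h' : M.Indep (({u} : Finset α) : Set α) <;>
      simp only [setupStepAlg, run, setupStep, h, h', decide_true, decide_false, if_true, if_false,
        Bool.false_eq_true]

/-- The oracle version of `setup`. -/
noncomputable def setupAlg (α : Type u) [DecidableEq α] [Fintype α] :
    OracleAlg α (Finset α × ℝ) :=
  fold setupStepAlg (Finset.univ : Finset α).toList (∅, 0)

theorem run_setupAlg (M : Matroid α) (f : Finset α → ℝ) :
    (setupAlg α).run M f = setup M f := by
  simp only [setupAlg, run_fold, run_setupStepAlg]; rfl

theorem valueQueries_setupAlg_le (M : Matroid α) (f : Finset α → ℝ) :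
    (setupAlg α).valueQueries M f ≤ Fintype.card α * 1 := by
  have := valueQueries_fold_le M f (setupStepAlg (α := α)) 1
    (fun u s => by simp [setupStepAlg, valueQueries]) (Finset.univ : Finset α).toList (∅, 0)
  rwa [Finset.length_toList] at this

theorem indepQueries_setupAlg_le (M : Matroid α) (f : Finset α → ℝ) :
    (setupAlg α).indepQueries M f ≤ Fintype.card α * 2 := by
  have := indepQueries_fold_le M f (setupStepAlg (α := α)) 2
    (fun u s => by simp [setupStepAlg, indepQueries]) (Finset.univ : Finset α).toList (∅, 0)
  rwa [Finset.length_toList] at this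

end Algorithms

end OracleAlg

/-! ### The fractional solution built from the splits, and its rounding. -/

section Output

variable {α : Type u} [DecidableEq α] {ℓ : ℕ}

theorem count_pieces {T : Fin ℓ → Finset α} (hT : Pairwise fun i j => Disjoint (T i) (T j))
    (u : α) :
    ((List.ofFn T).flatMap Finset.toList).count u = if u ∈ pieceUnion T then 1 else 0 := by
  have h : ∀ S : Finset α, S.toList.count u = if u ∈ S then 1 else 0 := by
    intro S
    split_ifs with hu
    · exact List.count_eq_one_of_mem S.nodup_toList (Finset.mem_toList.2 hu)
    · exact List.count_eq_zero_of_not_mem (by simpa using hu)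
  rw [List.count_flatMap, List.map_ofFn, List.sum_ofFn]
  simp only [Function.comp_apply, h, pieceUnion, Finset.mem_biUnion, Finset.mem_univ, true_and]
  split_ifs with hu
  · obtain ⟨j, hj⟩ := hu
    rw [Finset.sum_eq_single j]
    · simp [hj]
    · intro i _ hij
      rw [if_neg fun hi => Finset.disjoint_left.1 (hT hij) hi hj]
    · simp
  · push Not at hu
    exact Finset.sum_eq_zero fun i _ => if_neg (hu i)

/-- The unions of the first `m` splits of a list. -/
def splitUnions (m : ℕ) (H : List (Fin ℓ → Finset α)) (i : Fin m) : Finset α :=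
  pieceUnion (H.getD i fun _ => ∅)

/-- Pieces of one split are disjoint, so an element is listed at most once per split. -/
theorem coverCount_splitUnions {m : ℕ} {H : List (Fin ℓ → Finset α)} (hm : H.length = m)
    (hH : ∀ T ∈ H, Pairwise fun i j => Disjoint (T i) (T j)) (u : α) :
    coverCount (splitUnions m H) u = ((allPieces H).flatMap Finset.toList).count u := by
  induction H generalizing m with
  | nil => subst hm; simp [coverCount, allPieces]
  | cons T H ih =>
    subst hm
    simp only [List.mem_cons, forall_eq_or_imp] at hH
    rw [allPieces, List.flatMap_cons, List.flatMap_append, List.count_append, count_pieces hH.1]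
    have := ih rfl hH.2
    rw [allPieces] at this
    rw [← this, coverCount, coverCount]
    exact Fin.card_filter_univ_succ' _

theorem splitUnions_indep {M : Matroid α} {m : ℕ} {H : List (Fin ℓ → Finset α)}
    (hm : H.length = m) (hH : ∀ T ∈ H, M.Indep (pieceUnion T : Set α)) (i : Fin m) :
    M.Indep (splitUnions m H i : Set α) := by
  have hi : (i : ℕ) < H.length := hm ▸ i.2
  rw [splitUnions, List.getD_eq_getElem _ _ hi]
  exact hH _ (List.getElem_mem hi)

variable [Fintype α]

open Classical in
/-- The fractional solution of a list of splits, and its rounding. -/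
noncomputable def splitOutput (m : ℕ) (δ : ℝ) (H : List (Fin ℓ → Finset α)) :
    FractionalOutput α m where
  y := occurProb δ (allPieces H)
  law :=
    if h : (∀ u, 0 ≤ marg (occurProb δ (allPieces H)) u) ∧
        ∀ u, marg (occurProb δ (allPieces H)) u ≤ (coverCount (splitUnions m H) u : ℝ) / m
    then (productPMF _ (keepProb_mem_Icc h.1 h.2)).map fun Q i => splitUnions m H i ∩ Q
    else PMF.pure fun _ => ∅

theorem splitOutput_spec {M : Matroid α} {f : Finset α → ℝ} (hf : IsSubmodular f) {m : ℕ}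
    (hm0 : m ≠ 0) {H : List (Fin ℓ → Finset α)} (hm : H.length = m)
    (hI : ∀ T ∈ H, M.Indep (pieceUnion T : Set α))
    (hH : ∀ T ∈ H, Pairwise fun i j => Disjoint (T i) (T j)) :
    let out := splitOutput m (1 / m) H
    (∀ S, out.y S ∈ Set.Icc (0 : ℝ) 1) ∧ marg out.y ∈ matroidPolytope M ∧
      suppSize out.y ≤ m * ℓ ∧
      extMultilinearExt f out.y = randUnion (1 / m) f (allPieces H) ∅ ∧
      (∀ S ∈ out.law.support, ∀ i, M.Indep (S i : Set α)) ∧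
      extMultilinearExt f out.y ≤ expectedMultilinearExt f out.law := by
  intro out
  have hm1 : (1 : ℝ) ≤ m := by exact_mod_cast Nat.one_le_iff_ne_zero.2 hm0
  have hδ0 : (0 : ℝ) ≤ 1 / m := by positivity
  have hδ1 : 1 / (m : ℝ) ≤ 1 := div_le_one_of_le₀ hm1 (by positivity)
  have h0 : ∀ u, 0 ≤ marg (occurProb (1 / m) (allPieces H)) u := fun u => by
    rw [marg_occurProb]; exact (occurProb_mem_Icc hδ0 hδ1 _ _).1
  have h1 : ∀ u, marg (occurProb (1 / m) (allPieces H)) u ≤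
      (coverCount (splitUnions m H) u : ℝ) / m := fun u => by
    rw [marg_occurProb, coverCount_splitUnions hm hH, occurProb]
    -- Bernoulli's inequality: `1 - (1 - 1/m) ^ c ≤ c / m`.
    have := one_add_mul_le_pow (a := -(1 / (m : ℝ))) (by linarith)
      (((allPieces H).flatMap Finset.toList).count u)
    rw [← sub_eq_add_neg] at this
    have e : ((((allPieces H).flatMap Finset.toList).count u : ℕ) : ℝ) / m
      = (((allPieces H).flatMap Finset.toList).count u : ℕ) * (1 / m) := by ring
    rw [e]
    linarith
  have hlaw : out.law = (productPMF _ (keepProb_mem_Icc h0 h1)).map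
      fun Q i => splitUnions m H i ∩ Q := dif_pos ⟨h0, h1⟩
  have hB := splitUnions_indep hm hI
  refine ⟨fun S => occurProb_mem_Icc hδ0 hδ1 _ _, mem_matroidPolytope_of_le hm0 hB h0 h1, ?_,
    extMultilinearExt_occurProb _ _ _, ?_, ?_⟩
  · refine (suppSize_occurProb_le _ _).trans ?_
    rw [length_allPieces, hm]
  · intro S hS i
    rw [hlaw, PMF.mem_support_map_iff] at hS
    obtain ⟨Q, -, rfl⟩ := hS
    exact (hB i).subset (by simp)
  · rw [hlaw, expectedMultilinearExt_keepProb f h0 h1]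
    change extMultilinearExt f (occurProb (1 / m) (allPieces H)) ≤ _
    rw [extMultilinearExt_occurProb, marg_occurProb]
    refine (hf.randUnion_le_singletons hδ0 hδ1 _ _).trans_eq ?_
    rw [← multilinearExt_occurProb]
    simp

end Output

/-! ### The recurrence for the value over the iterations. -/

section Analysis

variable {α : Type u} [DecidableEq α] [Fintype α] {ℓ : ℕ}

/-- The expectation of `f` on `S` together with the random union of the first `i` splits. -/
noncomputable def splitValue (ℓ : ℕ) (M : Matroid α) (f : Finset α → ℝ) (δ q W : ℝ) (K i : ℕ) :
    Finset α → ℝ :=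
  randUnion δ f (allPieces (iteratedSplit ℓ M f δ q W K i))

theorem splitValue_succ (M : Matroid α) (f : Finset α → ℝ) (δ q W : ℝ) (K i : ℕ)
    (S : Finset α) :
    splitValue ℓ M f δ q W K (i + 1) S =
      randUnion δ (splitValue ℓ M f δ q W K i)
        (List.ofFn (greedySplit ℓ M (splitValue ℓ M f δ q W K i) q W K)) S := by
  simp only [splitValue, iteratedSplit]
  rw [allPieces, List.flatMap_cons, randUnion_append]
  rfl

/-- The assumptions on the instance and the parameters. -/
structure SplitSetting (M : Matroid α) (f : Finset α → ℝ) (δ q W : ℝ) : Prop where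
  ground : M.E = Set.univ
  nonneg : ∀ S, 0 ≤ f S
  submod : IsSubmodular f
  δ_nonneg : 0 ≤ δ
  δ_le : δ ≤ 1
  q_pos : 0 < q
  q_le : q ≤ 1
  W_nonneg : 0 ≤ W
  le_W : ∀ u, M.Indep {u} → f {u} ≤ W

variable {M : Matroid α} {f : Finset α → ℝ} {δ q W : ℝ}

namespace SplitSetting

theorem greedySplit_spec (h : SplitSetting M f δ q W) (ℓ : ℕ) (L : List (Finset α)) (K : ℕ) :
    IsSplit M (randUnion δ f L) (greedySplit ℓ M (randUnion δ f L) q W K) ∧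
      ExcessBounded M (randUnion δ f L) q (W * q ^ K)
        (greedySplit ℓ M (randUnion δ f L) q W K) := by
  refine _root_.greedySplit_spec h.ground (randUnion_isSubmodular h.δ_nonneg h.δ_le h.submod L)
    h.q_pos h.q_le h.W_nonneg (fun u hu => ?_) ℓ K
  have := h.submod.randUnion_insert_sub_le h.δ_nonneg h.δ_le h.nonneg L u ∅
  exact (by simpa using this : _ ≤ _).trans (h.le_W u hu)

theorem mem_iteratedSplit (h : SplitSetting M f δ q W) (K i : ℕ) :
    ∀ T ∈ iteratedSplit ℓ M f δ q W K i,
      M.Indep (pieceUnion T : Set α) ∧ Pairwise fun i j => Disjoint (T i) (T j) := by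
  induction i with
  | zero => simp [iteratedSplit]
  | succ i ih =>
    simp only [iteratedSplit, List.mem_cons, forall_eq_or_imp]
    have := (h.greedySplit_spec ℓ (allPieces (iteratedSplit ℓ M f δ q W K i)) K).1
    exact ⟨⟨this.indep, this.disjoint⟩, ih⟩

theorem splitValue_nonneg (h : SplitSetting M f δ q W) (K i : ℕ) (S : Finset α) :
    0 ≤ splitValue ℓ M f δ q W K i S :=
  randUnion_nonneg h.δ_nonneg h.δ_le h.nonneg _ _

theorem splitValue_isSubmodular (h : SplitSetting M f δ q W) (K i : ℕ) :
    IsSubmodular (splitValue ℓ M f δ q W K i) :=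
  randUnion_isSubmodular h.δ_nonneg h.δ_le h.submod _

/-- The pieces of one split are disjoint, so a whole split costs only one factor `1 - δ`, not one
per piece. -/
theorem pow_mul_le_splitValue (h : SplitSetting M f δ q W) (K i : ℕ) (O : Finset α) :
    (1 - δ) ^ i * f O ≤ splitValue ℓ M f δ q W K i O := by
  induction i with
  | zero => simp [splitValue, iteratedSplit, allPieces, randUnion]
  | succ i ih =>
    rw [splitValue_succ]
    have h1 := (h.greedySplit_spec ℓ (allPieces (iteratedSplit ℓ M f δ q W K i)) K).1
    have h2 := (h.splitValue_isSubmodular (ℓ := ℓ) K i).sub_mul_le_randUnion h.δ_nonneg h.δ_le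
      (h.splitValue_nonneg K i) h1.pairwise_ofFn O
    refine le_trans ?_ h2
    rw [pow_succ', mul_assoc]
    exact mul_le_mul_of_nonneg_left ih (sub_nonneg.2 h.δ_le)

theorem le_splitValue_succ (h : SplitSetting M f δ q W) (hℓ : ℓ ≠ 0) {η : ℝ} (hη : 0 ≤ η)
    (hq : 1 / q ≤ 1 + η) (hρ : 1 / (ℓ : ℝ) + η + ℓ * δ ≤ 1) {O : Finset α}
    (hO : M.Indep (O : Set α)) {K : ℕ} {κ e : ℝ} (he : O.card * (W * q ^ K) ≤ e) (i : ℕ)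
    (hκ : κ ≤ avgUnion (splitValue ℓ M f δ q W K i)
      (greedySplit ℓ M (splitValue ℓ M f δ q W K i) q W K) O) :
    (1 - δ) * splitValue ℓ M f δ q W K i ∅ + δ * ((1 - (1 / ℓ + η + ℓ * δ)) * (κ - e)) ≤
      splitValue ℓ M f δ q W K (i + 1) ∅ := by
  obtain ⟨h1, h2⟩ := h.greedySplit_spec ℓ (allPieces (iteratedSplit ℓ M f δ q W K i)) K
  have hσ : 0 ≤ W * q ^ K := mul_nonneg h.W_nonneg (pow_nonneg h.q_pos.le _)
  have h3 := h1.le_randUnion (h.splitValue_isSubmodular K i) (h.splitValue_nonneg K i) hℓ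
    h.δ_nonneg h.δ_le hη hq hρ (e := e) (O := O) fun j =>
      (h2.union_sub_le (h.splitValue_isSubmodular K i) hσ hO j).trans (by linarith)
  rw [splitValue_succ]
  refine le_trans ?_ h3
  have hmul := mul_le_mul_of_nonneg_left (mul_le_mul_of_nonneg_left
    (sub_le_sub_right hκ e) (sub_nonneg.2 hρ)) h.δ_nonneg
  exact add_le_add le_rfl hmul

end SplitSetting

/-- Solving the recurrence of the non-monotone case. -/
theorem le_of_recurrence_pow {a : ℕ → ℝ} {δ c e : ℝ} (hδ0 : 0 ≤ δ) (hδ1 : δ ≤ 1) (he : 0 ≤ e)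
    (ha : ∀ i, 0 ≤ a i)
    (h : ∀ i, (1 - δ) * a i + δ * (c * (1 - δ) ^ i - e) ≤ a (i + 1)) (i : ℕ) :
    (i + 1) * δ * (c * (1 - δ) ^ i - e) ≤ a (i + 1) := by
  induction i with
  | zero =>
    have := h 0
    have := mul_nonneg (sub_nonneg.2 hδ1) (ha 0)
    push_cast; linarith
  | succ i ih =>
    have h1 := h (i + 1)
    have h2 := mul_le_mul_of_nonneg_left ih (sub_nonneg.2 hδ1)
    -- The accumulated error is also shrunk by `1 - δ`; this is the part of it that is given away.
    have h3 : 0 ≤ δ * ((i + 1) * δ * e) := by positivity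
    rw [pow_succ'] at h1 ⊢
    push_cast
    linarith

/-- Solving the recurrence of the monotone case. -/
theorem le_of_recurrence_const {a : ℕ → ℝ} {δ c : ℝ} (hδ1 : δ ≤ 1)
    (ha : 0 ≤ a 0) (h : ∀ i, (1 - δ) * a i + δ * c ≤ a (i + 1)) (i : ℕ) :
    (1 - (1 - δ) ^ i) * c ≤ a i := by
  induction i with
  | zero => simpa using ha
  | succ i ih =>
    have h1 := h i
    have h2 := mul_le_mul_of_nonneg_left ih (sub_nonneg.2 hδ1)
    rw [pow_succ']
    linarith

end Analysis

/-! ### Number of thresholds and numerical estimates. -/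

section Parameters

/-- The number of thresholds after which the neglected marginals are negligible. -/
noncomputable def numThresholds (η : ℝ) (r : ℕ) : ℕ :=
  ⌈Real.log (max (r : ℝ) 2 / η) / Real.log (1 + η)⌉₊

theorem mul_pow_numThresholds_le {η : ℝ} (hη : 0 < η) (r : ℕ) :
    r * (1 / (1 + η)) ^ numThresholds η r ≤ η := by
  have h2 : (0 : ℝ) < max (r : ℝ) 2 / η := div_pos (lt_max_of_lt_right two_pos) hη
  have hlog : 0 < Real.log (1 + η) := Real.log_pos (by linarith)
  have h : max (r : ℝ) 2 / η ≤ (1 + η) ^ numThresholds η r := by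
    rw [← Real.log_le_log_iff h2 (by positivity), Real.log_pow, ← div_le_iff₀ hlog]
    exact Nat.le_ceil _
  rw [one_div, inv_pow, ← div_eq_mul_inv, div_le_iff₀ (by positivity)]
  rw [div_le_iff₀ hη] at h
  linarith [le_max_left (r : ℝ) 2]

theorem half_le_log_max (r : ℕ) : 1 / 2 ≤ Real.log (max (r : ℝ) 2) := by
  have h1 : Real.log 2 ≤ Real.log (max (r : ℝ) 2) :=
    Real.log_le_log two_pos (le_max_right _ _)
  have := Real.log_two_gt_d9
  linarith

/-- Since the logarithm of `max r 2` is at least `1/2`, additive constants are absorbed at the price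
of a factor `2`. -/
theorem numThresholds_le {η : ℝ} (hη : 0 < η) (r : ℕ) :
    (numThresholds η r : ℝ) ≤
      ((1 + 2 * |Real.log η|) / Real.log (1 + η) + 2) * Real.log (max (r : ℝ) 2) := by
  have hlog : 0 < Real.log (1 + η) := Real.log_pos (by linarith)
  have hmax : (2 : ℝ) ≤ max (r : ℝ) 2 := le_max_right _ _
  have hΛ := half_le_log_max r
  have h0 : 0 ≤ |Real.log η| := abs_nonneg _
  have h1 : Real.log (max (r : ℝ) 2 / η) ≤ (1 + 2 * |Real.log η|) * Real.log (max (r : ℝ) 2) := by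
    rw [Real.log_div (by linarith) hη.ne']
    have := neg_abs_le (Real.log η)
    nlinarith
  have h2 : (numThresholds η r : ℝ) ≤
      (1 + 2 * |Real.log η|) * Real.log (max (r : ℝ) 2) / Real.log (1 + η) + 1 := by
    have hnn : 0 ≤ (1 + 2 * |Real.log η|) * Real.log (max (r : ℝ) 2) / Real.log (1 + η) := by
      positivity
    refine (Nat.cast_le.2 (Nat.ceil_mono (div_le_div_of_nonneg_right h1 hlog.le))).trans ?_
    exact (Nat.ceil_lt_add_one hnn).le
  refine h2.trans ?_
  have e : (1 + 2 * |Real.log η|) * Real.log (max (r : ℝ) 2) / Real.log (1 + η) =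
      (1 + 2 * |Real.log η|) / Real.log (1 + η) * Real.log (max (r : ℝ) 2) := by ring
  rw [e, add_mul]
  linarith

/-- For `m > 0` the base is `(1 + 1/m)⁻¹`, which is at least `exp (-1/m)`. -/
theorem exp_neg_one_le_pow {m : ℕ} : Real.exp (-1) ≤ (1 - 1 / ((m + 1 : ℕ) : ℝ)) ^ m := by
  rcases Nat.eq_zero_or_pos m with rfl | hm
  · simp
  · have hm' : (0 : ℝ) < m := by exact_mod_cast hm
    have h1 : Real.exp (-(1 / (m : ℝ))) ≤ 1 - 1 / ((m + 1 : ℕ) : ℝ) := by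
      have e : 1 - 1 / ((m + 1 : ℕ) : ℝ) = (1 + 1 / (m : ℝ))⁻¹ := by
        push_cast; field_simp; ring
      rw [e, Real.exp_neg]
      apply inv_anti₀ (by positivity)
      linarith [Real.add_one_le_exp (1 / (m : ℝ))]
    calc Real.exp (-1) = Real.exp (-(1 / (m : ℝ))) ^ m := by
          rw [← Real.exp_nat_mul]; congr 1; field_simp
      _ ≤ _ := pow_le_pow_left₀ (Real.exp_pos _).le h1 m

theorem exp_neg_one_bounds : 0.367 < Real.exp (-1) ∧ Real.exp (-1) < 0.368 := by
  have h1 := Real.exp_one_gt_d9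
  have h2 := Real.exp_one_lt_d9
  rw [Real.exp_neg, inv_eq_one_div]
  constructor
  · rw [lt_div_iff₀ (by positivity)]; linarith
  · rw [div_lt_iff₀ (by positivity)]; linarith

/-- The product loses at most `2.51 * s` relative to `1/e`, and `2.51 * 0.368 + 0.01 < 1`. The
fraction `1/100` in the threshold ratio leaves room for this. -/
theorem nonmonotone_ratio {s : ℝ} (h0 : 0 ≤ s) (h1 : s ≤ 1 / 2) :
    Real.exp (-1) - s ≤ (1 - (s + s / 100 + s ^ 2)) * (1 - s) * Real.exp (-1) -
      (1 - (s + s / 100 + s ^ 2)) * (s / 100) := by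
  obtain ⟨hE, hE'⟩ := exp_neg_one_bounds
  have hs : s ^ 2 ≤ s / 2 := by nlinarith
  have h3 : 1 - 2.51 * s ≤ (1 - (s + s / 100 + s ^ 2)) * (1 - s) := by
    nlinarith [mul_nonneg h0 (show 0 ≤ s + s / 100 + s ^ 2 by positivity)]
  have h4 := mul_le_mul_of_nonneg_right h3 (show 0 ≤ Real.exp (-1) by linarith)
  have h5 : (1 - (s + s / 100 + s ^ 2)) * (s / 100) ≤ s / 100 := by
    nlinarith [mul_nonneg h0 (show 0 ≤ s + s / 100 + s ^ 2 by positivity)]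
  nlinarith

/-- Here the loss is `1.52 * s` relative to `1 - 1/e < 0.633`, again less than `s` in total. -/
theorem monotone_ratio {s : ℝ} (h0 : 0 ≤ s) (h1 : s ≤ 1 / 2) :
    1 - Real.exp (-1) - s ≤
      (1 - Real.exp (-1)) * ((1 - (s + s / 100 + s ^ 2)) * (1 - s / 100)) := by
  obtain ⟨hE, hE'⟩ := exp_neg_one_bounds
  have hs : s ^ 2 ≤ s / 2 := by nlinarith
  have h3 : 1 - 1.52 * s ≤ (1 - (s + s / 100 + s ^ 2)) * (1 - s / 100) := by
    nlinarith [mul_nonneg h0 (show 0 ≤ s + s / 100 + s ^ 2 by positivity)]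
  have h4 := mul_le_mul_of_nonneg_left h3 (show 0 ≤ 1 - Real.exp (-1) by linarith)
  nlinarith

end Parameters

/-! ### Choice of parameters and the final guarantees. -/

section Main

variable {α : Type u} [DecidableEq α] [Fintype α]

namespace SplitSetting

variable {M : Matroid α} {f : Finset α → ℝ} {N K : ℕ} {W : ℝ} {O : Finset α}

theorem nonmonotone_value (hN : 2 ≤ N)
    (h : SplitSetting M f (1 / ((N ^ 3 : ℕ) : ℝ)) (1 / (1 + 1 / (N : ℝ) / 100)) W)
    (hO : M.Indep (O : Set α))
    (he : O.card * (W * (1 / (1 + 1 / (N : ℝ) / 100)) ^ K) ≤ 1 / (N : ℝ) / 100 * f O) :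
    (Real.exp (-1) - 1 / N) * f O ≤
      splitValue N M f (1 / ((N ^ 3 : ℕ) : ℝ)) (1 / (1 + 1 / (N : ℝ) / 100)) W K (N ^ 3) ∅ := by
  have hN0 : N ≠ 0 := by omega
  have hN' : (2 : ℝ) ≤ N := by exact_mod_cast hN
  set s : ℝ := 1 / (N : ℝ) with hs
  set δ : ℝ := 1 / ((N ^ 3 : ℕ) : ℝ) with hδ
  have hs0 : 0 ≤ s := by positivity
  have hs1 : s ≤ 1 / 2 := one_div_le_one_div_of_le two_pos hN'
  have hNδ : N * δ = s ^ 2 := by rw [hδ, hs]; push_cast; field_simp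
  have hρ : s + s / 100 + N * δ ≤ 1 := by rw [hNδ]; nlinarith
  have hD := h.nonneg O
  have hrec := le_of_recurrence_pow (δ := δ)
    (a := fun i => splitValue N M f δ (1 / (1 + s / 100)) W K i ∅)
    (c := (1 - (s + s / 100 + N * δ)) * ((1 - s) * f O))
    (e := (1 - (s + s / 100 + N * δ)) * (s / 100 * f O)) h.δ_nonneg h.δ_le
    (mul_nonneg (sub_nonneg.2 hρ) (by positivity)) (fun i => h.splitValue_nonneg K i ∅)
    (fun i => by
      have hκ := le_avgUnion (h.splitValue_isSubmodular K i) (h.splitValue_nonneg K i)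
        (h.greedySplit_spec N (allPieces (iteratedSplit N M f δ _ W K i)) K).1 hN0 O
      have hκ' : (1 - s) * ((1 - δ) ^ i * f O) ≤ _ :=
        (mul_le_mul_of_nonneg_left (h.pow_mul_le_splitValue (ℓ := N) K i O) (by linarith)).trans hκ
      have := h.le_splitValue_succ hN0 (by positivity : 0 ≤ s / 100) (by rw [one_div_one_div]) hρ hO
        he i hκ'
      refine le_trans (le_of_eq ?_) this
      ring) (N ^ 3 - 1)
  -- The recurrence is read off at index `N ^ 3 - 1`: its prefactor becomes `1`, and the exponent is
  -- one less than the number of splits, which keeps the power above `1/e`.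
  have hm : N ^ 3 - 1 + 1 = N ^ 3 := Nat.sub_add_cancel (Nat.one_le_iff_ne_zero.2 (by positivity))
  have hmδ : (((N ^ 3 - 1 : ℕ) : ℝ) + 1) * δ = 1 := by
    rw [← Nat.cast_succ, Nat.succ_eq_add_one, hm, hδ]
    exact mul_one_div_cancel (by positivity)
  have hexp := exp_neg_one_le_pow (m := N ^ 3 - 1)
  rw [hm, ← hδ] at hexp
  rw [hmδ, one_mul, hm, hNδ] at hrec
  rw [hNδ] at hρ
  refine le_trans ?_ hrec
  have h1 := mul_le_mul_of_nonneg_right (nonmonotone_ratio hs0 hs1) hD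
  have h2 := mul_le_mul_of_nonneg_left hexp
    (mul_nonneg (sub_nonneg.2 hρ) (mul_nonneg (show 0 ≤ 1 - s by linarith) hD))
  linarith

theorem monotone_value (hN : 2 ≤ N)
    (h : SplitSetting M f (1 / ((N ^ 3 : ℕ) : ℝ)) (1 / (1 + 1 / (N : ℝ) / 100)) W)
    (hf : Monotone f) (hO : M.Indep (O : Set α))
    (he : O.card * (W * (1 / (1 + 1 / (N : ℝ) / 100)) ^ K) ≤ 1 / (N : ℝ) / 100 * f O) :
    (1 - Real.exp (-1) - 1 / N) * f O ≤
      splitValue N M f (1 / ((N ^ 3 : ℕ) : ℝ)) (1 / (1 + 1 / (N : ℝ) / 100)) W K (N ^ 3) ∅ := by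
  have hN0 : N ≠ 0 := by omega
  have hN' : (2 : ℝ) ≤ N := by exact_mod_cast hN
  set s : ℝ := 1 / (N : ℝ) with hs
  set δ : ℝ := 1 / ((N ^ 3 : ℕ) : ℝ) with hδ
  have hs0 : 0 ≤ s := by positivity
  have hs1 : s ≤ 1 / 2 := one_div_le_one_div_of_le two_pos hN'
  have hNδ : N * δ = s ^ 2 := by rw [hδ, hs]; push_cast; field_simp
  have hρ : s + s / 100 + N * δ ≤ 1 := by rw [hNδ]; nlinarith
  have hD := h.nonneg O
  have hrec := le_of_recurrence_const (δ := δ)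
    (a := fun i => splitValue N M f δ (1 / (1 + s / 100)) W K i ∅)
    (c := (1 - (s + s / 100 + N * δ)) * (f O - s / 100 * f O)) h.δ_le
    (h.splitValue_nonneg K 0 ∅)
    (fun i => h.le_splitValue_succ hN0 (by positivity : 0 ≤ s / 100) (by rw [one_div_one_div]) hρ hO
        he i ((le_randUnion h.δ_nonneg h.δ_le hf _ O).trans
          (le_avgUnion_of_monotone (randUnion_monotone h.δ_nonneg h.δ_le hf _) _ hN0 O))) (N ^ 3)
  have hexp : (1 - δ) ^ (N ^ 3) ≤ Real.exp (-1) := by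
    rw [hδ]
    exact Real.one_sub_div_pow_le_exp_neg (by
      exact_mod_cast Nat.one_le_iff_ne_zero.2 (by positivity))
  rw [hNδ] at hrec hρ
  refine le_trans ?_ hrec
  have h1 := mul_le_mul_of_nonneg_right (monotone_ratio hs0 hs1) hD
  have h2 := mul_le_mul_of_nonneg_right hexp
    (mul_nonneg (sub_nonneg.2 hρ) (mul_nonneg (show 0 ≤ 1 - s / 100 by linarith) hD))
  linarith

end SplitSetting

/-- The algorithm with `N` pieces per split and `N ^ 3` splits. -/
noncomputable def fractionalAlg (α : Type u) [Fintype α] [DecidableEq α] (N : ℕ) :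
    OracleAlg α (FractionalOutput α (N ^ 3)) :=
  (OracleAlg.setupAlg α).bind fun s =>
    (OracleAlg.iteratedAlg N (1 / ((N ^ 3 : ℕ) : ℝ)) (1 / (1 + 1 / (N : ℝ) / 100)) s.2
      (numThresholds (1 / (N : ℝ) / 100) s.1.card) (N ^ 3)).bind fun H =>
        .ret (splitOutput (N ^ 3) (1 / ((N ^ 3 : ℕ) : ℝ)) H)

/-- The factor in the query bound. -/
noncomputable def queryFactor (N : ℕ) : ℝ :=
  4 + (N : ℝ) ^ 3 * (((1 + 2 * |Real.log (1 / (N : ℝ) / 100)|) /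
    Real.log (1 + 1 / (N : ℝ) / 100) + 2) * (N * (2 * 2 ^ (N ^ 3 * N))))

theorem queries_le {N n r : ℕ} (hN : N ≠ 0) {Q : ℕ} (hQ : Q ≤ n * 2 +
    N ^ 3 * (numThresholds (1 / (N : ℝ) / 100) r * (n * N * (2 * 2 ^ (N ^ 3 * N))))) :
    (Q : ℝ) ≤ queryFactor N * (n * Real.log (max (r : ℝ) 2)) := by
  have hη : 0 < 1 / (N : ℝ) / 100 := by positivity
  have h1 := numThresholds_le hη r
  have h2 := half_le_log_max r
  have hQ' : (Q : ℝ) ≤ n * 2 + N ^ 3 * (numThresholds (1 / (N : ℝ) / 100) r *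
      (n * N * (2 * 2 ^ (N ^ 3 * N)))) := by exact_mod_cast hQ
  refine hQ'.trans ?_
  rw [queryFactor, add_mul]
  refine add_le_add ?_ ?_
  · have : (0 : ℝ) ≤ n := Nat.cast_nonneg n
    nlinarith
  · have h3 := mul_le_mul_of_nonneg_right h1
      (show (0 : ℝ) ≤ N ^ 3 * (n * N * (2 * 2 ^ (N ^ 3 * N))) by positivity)
    linarith

theorem fractionalAlg_valueQueries {M : Matroid α} (hE : M.E = Set.univ) (f : Finset α → ℝ)
    {N : ℕ} (hN : N ≠ 0) :
    ((fractionalAlg α N).valueQueries M f : ℝ) ≤ queryFactor N *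
      (Fintype.card α * Real.log (max (M.eRank.toNat : ℝ) 2)) := by
  refine queries_le hN ?_
  have h1 := OracleAlg.valueQueries_setupAlg_le (α := α) M f
  simp only [fractionalAlg, OracleAlg.valueQueries_bind, OracleAlg.run_setupAlg,
    OracleAlg.valueQueries, add_zero, setup_card hE]
  have h2 := OracleAlg.valueQueries_iteratedAlg_le (ℓ := N) M f (1 / ((N ^ 3 : ℕ) : ℝ))
    (1 / (1 + 1 / (N : ℝ) / 100)) (setup M f).2
    (numThresholds (1 / (N : ℝ) / 100) M.eRank.toNat) (N ^ 3) (N ^ 3) le_rfl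
  omega

theorem fractionalAlg_indepQueries {M : Matroid α} (hE : M.E = Set.univ) (f : Finset α → ℝ)
    {N : ℕ} (hN : N ≠ 0) :
    ((fractionalAlg α N).indepQueries M f : ℝ) ≤ queryFactor N *
      (Fintype.card α * Real.log (max (M.eRank.toNat : ℝ) 2)) := by
  refine queries_le hN ?_
  have h1 := OracleAlg.indepQueries_setupAlg_le (α := α) M f
  simp only [fractionalAlg, OracleAlg.indepQueries_bind, OracleAlg.run_setupAlg,
    OracleAlg.indepQueries, add_zero, setup_card hE]
  have h2 := OracleAlg.indepQueries_iteratedAlg_le (ℓ := N) M f (1 / ((N ^ 3 : ℕ) : ℝ))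
    (1 / (1 + 1 / (N : ℝ) / 100)) (setup M f).2
    (numThresholds (1 / (N : ℝ) / 100) M.eRank.toNat) (N ^ 3)
  refine add_le_add h1 (h2.trans ?_)
  gcongr
  have := Nat.one_le_two_pow (n := N ^ 3 * N)
  omega

theorem fractionalAlg_spec {M : Matroid α} {f : Finset α → ℝ} {ε : ℝ} {N : ℕ}
    (hE : M.E = Set.univ) (hf0 : ∀ S, 0 ≤ f S) (hf : IsSubmodular f)
    (hN : 2 ≤ N) (hinv : 1 / (N : ℝ) ≤ ε) (hNle : (N : ℝ) ≤ 2 / ε) :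
    let out := (fractionalAlg α N).run M f
    (∀ S, out.y S ∈ Set.Icc (0 : ℝ) 1) ∧
    marg out.y ∈ matroidPolytope M ∧
    (suppSize out.y : ℝ) ≤ 16 / ε ^ 4 ∧
    (∀ O, IsOptimal M f O →
      (1 / Real.exp 1 - ε) * f O ≤ extMultilinearExt f out.y) ∧
    (Monotone f → ∀ O, IsOptimal M f O →
      (1 - 1 / Real.exp 1 - ε) * f O ≤ extMultilinearExt f out.y) ∧
    ((fractionalAlg α N).valueQueries M f : ℝ) ≤
      queryFactor N * (Fintype.card α * Real.log (max (M.eRank.toNat : ℝ) 2)) ∧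
    ((fractionalAlg α N).indepQueries M f : ℝ) ≤
      queryFactor N * (Fintype.card α * Real.log (max (M.eRank.toNat : ℝ) 2)) ∧
    (∀ S ∈ out.law.support, ∀ i, M.Indep (S i : Set α)) ∧
    extMultilinearExt f out.y ≤ expectedMultilinearExt f out.law := by
  intro out
  have hN0 : N ≠ 0 := by omega
  have hm1 : (1 : ℝ) ≤ ((N ^ 3 : ℕ) : ℝ) := by
    exact_mod_cast Nat.one_le_iff_ne_zero.2 (by positivity)
  have hη : 0 < 1 / (N : ℝ) / 100 := by positivity
  obtain ⟨hW1, hW2, hW3⟩ := foldl_setupStep_snd (M := M) f (Finset.univ : Finset α).toList (∅, 0)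
  have hset : SplitSetting M f (1 / ((N ^ 3 : ℕ) : ℝ)) (1 / (1 + 1 / (N : ℝ) / 100))
      (setup M f).2 :=
    { ground := hE
      nonneg := hf0
      submod := hf
      δ_nonneg := by positivity
      δ_le := div_le_one_of_le₀ hm1 (by positivity)
      q_pos := by positivity
      q_le := div_le_one_of_le₀ (by linarith) (by positivity)
      W_nonneg := hW1
      le_W := fun u hu => hW2 u (by simp) hu }
  set Kt := numThresholds (1 / (N : ℝ) / 100) (setup M f).1.card with hKt
  have hout : out = splitOutput (N ^ 3) (1 / ((N ^ 3 : ℕ) : ℝ)) (iteratedSplit N M f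
      (1 / ((N ^ 3 : ℕ) : ℝ)) (1 / (1 + 1 / (N : ℝ) / 100)) (setup M f).2 Kt (N ^ 3)) := by
    simp only [out, fractionalAlg, OracleAlg.run_bind, OracleAlg.run_setupAlg,
      OracleAlg.run_iteratedAlg, OracleAlg.run, hKt]
  obtain ⟨s1, s2, s3, s4, s5, s6⟩ := splitOutput_spec (M := M) hf (pow_ne_zero 3 hN0)
    (length_iteratedSplit (ℓ := N) M f (1 / ((N ^ 3 : ℕ) : ℝ)) (1 / (1 + 1 / (N : ℝ) / 100))
      (setup M f).2 Kt (N ^ 3))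
    (fun T hT => (hset.mem_iteratedSplit Kt _ T hT).1)
    (fun T hT => (hset.mem_iteratedSplit Kt _ T hT).2)
  rw [← hout] at s1 s2 s3 s4 s5 s6
  have herr : ∀ O, IsOptimal M f O → O.card * ((setup M f).2 *
      (1 / (1 + 1 / (N : ℝ) / 100)) ^ Kt) ≤ 1 / (N : ℝ) / 100 * f O := by
    intro O hO
    -- Independent singletons compete with `O`, so the marginals neglected below the last threshold
    -- total at most a small fraction of `f O`.
    have hWD : (setup M f).2 ≤ f O :=
      hW3 (f O) (hf0 O) fun u hu => hO.2 {u} (by simpa using hu)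
    have hcard : (O.card : ℝ) ≤ (setup M f).1.card := by
      exact_mod_cast card_le_setup_card hE f hO.1
    calc O.card * ((setup M f).2 * (1 / (1 + 1 / (N : ℝ) / 100)) ^ Kt)
        ≤ (setup M f).1.card * (f O * (1 / (1 + 1 / (N : ℝ) / 100)) ^ Kt) := by
          have := hset.W_nonneg
          have := hf0 O
          gcongr
      _ = ((setup M f).1.card * (1 / (1 + 1 / (N : ℝ) / 100)) ^ Kt) * f O := by ring
      _ ≤ _ := mul_le_mul_of_nonneg_right (mul_pow_numThresholds_le hη _) (hf0 O)
  have hexp : 1 / Real.exp 1 = Real.exp (-1) := by rw [Real.exp_neg, one_div]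
  refine ⟨s1, s2, ?_, ?_, ?_, fractionalAlg_valueQueries hE f hN0,
    fractionalAlg_indepQueries hE f hN0, s5, s6⟩
  · calc (suppSize out.y : ℝ) ≤ ((N ^ 3 * N : ℕ) : ℝ) := by exact_mod_cast s3
      _ = (N : ℝ) ^ 4 := by push_cast; ring
      _ ≤ (2 / ε) ^ 4 := by gcongr
      _ = 16 / ε ^ 4 := by rw [div_pow]; norm_num
  · intro O hO
    rw [s4, hexp]
    refine le_trans ?_ (hset.nonmonotone_value hN hO.1 (herr O hO))
    exact mul_le_mul_of_nonneg_right (by linarith) (hf0 O)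
  · intro hmono O hO
    rw [s4, hexp]
    refine le_trans ?_ (hset.monotone_value hN hmono hO.1 (herr O hO))
    exact mul_le_mul_of_nonneg_right (by linarith) (hf0 O)

end Main

theorem theorem1 :
    ∃ (C : ℝ) (K : ℝ → ℝ)
      (A : ∀ (α : Type u) [Fintype α] [DecidableEq α] (ε : ℝ),
        OracleAlg α (FractionalOutput α (⌈1 / ε⌉₊ ^ 3))),
      ∀ (α : Type u) [Fintype α] [DecidableEq α] (M : Matroid α) (f : Finset α → ℝ) (ε : ℝ),
        M.E = Set.univ → (∀ S, 0 ≤ f S) → IsSubmodular f → 0 < ε → ε < 1 →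
        let out := (A α ε).run M f
        (∀ S, out.y S ∈ Set.Icc (0 : ℝ) 1) ∧
        marg out.y ∈ matroidPolytope M ∧
        (suppSize out.y : ℝ) ≤ C / ε ^ 4 ∧
        (∀ O, IsOptimal M f O →
          (1 / Real.exp 1 - ε) * f O ≤ extMultilinearExt f out.y) ∧
        (Monotone f → ∀ O, IsOptimal M f O →
          (1 - 1 / Real.exp 1 - ε) * f O ≤ extMultilinearExt f out.y) ∧
        ((A α ε).valueQueries M f : ℝ) ≤
          K ε * (Fintype.card α * Real.log (max (M.eRank.toNat : ℝ) 2)) ∧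
        ((A α ε).indepQueries M f : ℝ) ≤
          K ε * (Fintype.card α * Real.log (max (M.eRank.toNat : ℝ) 2)) ∧
        (∀ S ∈ out.law.support, ∀ i, M.Indep (S i : Set α)) ∧
        extMultilinearExt f out.y ≤ expectedMultilinearExt f out.law := by
  -- For `ε < 1`, `N = ⌈1/ε⌉` is at least `2` and at most `2 / ε`, so the `N ^ 4` pieces number at
  -- most `16 / ε ^ 4`.
  refine ⟨16, fun ε => queryFactor ⌈1 / ε⌉₊, fun α _ _ ε => fractionalAlg α ⌈1 / ε⌉₊, ?_⟩
  intro α _ _ M f ε hE hf0 hf hε0 hε1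
  have hN1 : 1 / ε ≤ (⌈1 / ε⌉₊ : ℝ) := Nat.le_ceil _
  have hNlt : (⌈1 / ε⌉₊ : ℝ) < 1 / ε + 1 := Nat.ceil_lt_add_one (by positivity)
  have h1ε : 1 < 1 / ε := (one_lt_div hε0).2 hε1
  have h2ε : 2 / ε = 1 / ε + 1 / ε := by ring
  refine fractionalAlg_spec hE hf0 hf (Nat.lt_ceil.2 (by simpa using h1ε)) ?_ (by linarith)
  rw [div_le_iff₀ (by linarith)]
  rw [div_le_iff₀ hε0] at hN1
  linarith
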